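/- A skew left brace is a set $B$ with two group structures $(B,\star)$ and $(B,\cdot)$ such that $a\cdot(b\star c)=(a\cdot b)\star a^{\star}\star(a\cdot c)$ for all $a,b,c$, where $a^\star$ is the inverse of $a$ in $(B,\star)$; the two identities coincide and are denoted $1$. Put $\lambda_a(b)=a^\star\star(a\cdot b)$, let $G=(B,\star)\rtimes_\lambda(B,\cdot)$, and let $G$ act on $(B,\star)$ by the automorphisms $\Theta_{(a,b)}(c)=a\star\lambda_b(c)\star a^\star$; write $\mathrm{St}(a)$ for the stabiliser of $a\in B$ and $\mathcal O$ for the set of orbits. A non-degenerate solution (of the Yang--Baxter equation) is a non-empty set $X$ with a bijection $r(x,y)=(f_x(y),g_y(x))$ of $X\times X$ such that $(r\times\mathrm{id})(\mathrm{id}\times r)(r\times\mathrm{id})=(\mathrm{id}\times r)(r\times\mathrm{id})(\mathrm{id}\times r)$ and all $f_x$, $g_y$ are bijective. It is square-free if $r(x,x)=(x,x)$ for all $x$. Its structure group is $G(X,r)=\langle X\mid xy=f_x(y)g_y(x)\rangle$ and its derived group is $A(X,r)=\langle X\mid x\star f_x(y)=f_x(y)\star f_{f_x(y)}g_y(x)\rangle$.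 $G(X,r)$ is a skew left brace whose star group is transported from $A(X,r)$ along the bijection $\varphi\colon G(X,r)\to A(X,r)$ with $\varphi(x)=x$ for $x\in X$ and $\varphi(bc)=\varphi(b)\star\lambda_b(\varphi(c))$, where $\lambda_x(y)=f_x(y)$ on generators. The permutation group $\mathcal G(X,r)\le \mathrm{Sym}_X\times\mathrm{Sym}_X$ is generated by the pairs $(f_x,\tilde g_x^{-1})$, $x\in X$, where $\tilde g_x(z)=g_{f_z^{-1}(x)}(z)$; it is a skew left brace as a quotient of $G(X,r)$. Let $B$ be a skew left brace, and choose an element $a_i\in i$ for each orbit $i\in\mathcal O$. Consider the following data: a non-empty subset $I\subseteq\mathcal O$ such that $\bigcup_{i\in I}i$ generates $(B,\star)$; for each $i\in I$ a non-empty set $J_i$; and for each $i\in I$, $j\in J_i$ a subgroup $K_{i,j}\le\mathrm{St}(a_i)$, such that $$\Bigl\{a\in B:(1,a),(a,a)\in\bigcap_{i\in I}\bigcap_{j\in J_i}\mathrm{core}_G(K_{i,j})\Bigr\}=\{1\}.$$ The constructed map $r$ on $X=\bigsqcup_{i\in I}\bigsqcup_{j\in J_i}G/K_{i,j}$ is $r(x,y)=(f_x(y),g_y(x))$,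 where for $x=(b_1,c_1)K_{i_1,j_1}$ and $y=(b_2,c_2)K_{i_2,j_2}$ $$f_x(y)=(1,\Theta_{(b_1,c_1)}(a_{i_1}))\,y,\qquad g_y(x)=(d,d)^{-1}x,\qquad d=\Theta_{(1,\Theta_{(b_1,c_1)}(a_{i_1}))}\Theta_{(b_2,c_2)}(a_{i_2}).$$ Proposition. (1) If, for all $b,c\in B$, $i\in I$, $j\in J_i$, both $(1,\Theta_{(b,c)}(a_i))$ and $(\Theta_{(b,c)}(a_i),\Theta_{(b,c)}(a_i))$ lie in $(b,c)K_{i,j}(b,c)^{-1}$, then $(X,r)$ is a square-free non-degenerate solution with $\mathcal G(X,r)\cong B$ as skew left braces. (2) Conversely, every square-free non-degenerate solution $(Z,t)$ arises in this way: for every skew left brace $B$ with $\mathcal G(Z,t)\cong B$ (for instance $B=\mathcal G(Z,t)$) and every choice of representatives $a_i$, there are data $I$, $J_i$, $K_{i,j}$ as above that satisfy the two conditions of (1) and for which $(Z,t)$ is isomorphic to the constructed solution $(X,r)$. -/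

import Mathlib

open Function

universe u v

/-! ### Skew left braces -/

/-- A skew left brace.  The multiplicative group `(B, ·)` is written multiplicatively and the star
group `(B, ⋆)`, which need not be commutative, is written additively: `a + b` is `a ⋆ b` and `-a`
is the inverse of `a` for `⋆`.  Isomorphisms of skew left braces are the bijections that preserve
both operations, that is, the elements of `A ≃+* B`. -/
class SkewLeftBrace (B : Type*) extends Group B, AddGroup B where
  brace_law : ∀ a b c : B, a * (b + c) = a * b + -a + a * c

namespace SkewLeftBrace

section basic
variable {B : Type*} [SkewLeftBrace B]

theorem mul_zero_eq (a : B) : a * (0 : B) = a := by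
  have h := brace_law a (0 : B) 0
  rw [add_zero, add_assoc] at h
  have h2 : -a + a * (0 : B) = 0 := by
    have := left_eq_add.mp h
    exact this
  exact (neg_add_eq_zero.mp h2).symm

theorem one_eq_zero : (1 : B) = 0 := by
  have h := mul_zero_eq (1 : B)
  rw [one_mul] at h
  exact h.symm

/-- The map `λ_a(b) = a^⋆ ⋆ (a · b)`. -/
def lamFun (a b : B) : B := -a + a * b

theorem mul_eq_add_lam (a b : B) : a * b = a + lamFun a b := by simp [lamFun]

theorem lamFun_add (a b c : B) : lamFun a (b + c) = lamFun a b + lamFun a c := by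
  simp [lamFun, brace_law, add_assoc]

theorem lamFun_one (b : B) : lamFun 1 b = b := by
  rw [lamFun, one_mul, one_eq_zero, neg_zero, zero_add]

theorem lamFun_neg (a b : B) : lamFun a (-b) = -lamFun a b := by
  rw [eq_neg_iff_add_eq_zero, ← lamFun_add, neg_add_cancel]
  simp [lamFun, mul_zero_eq]

theorem lamFun_mul (a b c : B) : lamFun (a * b) c = lamFun a (lamFun b c) := by
  have h : lamFun b c = -b + b * c := rfl
  rw [h, lamFun_add, lamFun_neg]
  simp [lamFun, add_assoc, mul_assoc]

end basic

variable (B : Type*) [SkewLeftBrace B]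

/-- The morphism `λ : (B, ·) → Aut (B, ⋆)`. -/
def lam : B →* MulAut (Multiplicative B) where
  toFun a :=
    { toFun := fun b => Multiplicative.ofAdd (lamFun a b.toAdd)
      invFun := fun b => Multiplicative.ofAdd (lamFun a⁻¹ b.toAdd)
      left_inv := fun b => by
        apply Multiplicative.toAdd.injective
        simp [← lamFun_mul, lamFun_one]
      right_inv := fun b => by
        apply Multiplicative.toAdd.injective
        simp [← lamFun_mul, lamFun_one]
      map_mul' := fun b c => by
        apply Multiplicative.toAdd.injective
        simp [lamFun_add] }
  map_one' := by
    ext b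
    apply Multiplicative.toAdd.injective
    simp [lamFun_one]
  map_mul' a a' := by
    ext b
    apply Multiplicative.toAdd.injective
    simp [lamFun_mul]

/-- The semidirect product `(B, ⋆) ⋊ (B, ·)` with respect to `λ`. -/
abbrev SemiProd : Type _ := SemidirectProduct (Multiplicative B) B (lam B)

variable {B}

/-- The element `(a, b)` of `(B, ⋆) ⋊ (B, ·)`. -/
def pair (a b : B) : SemiProd B := ⟨Multiplicative.ofAdd a, b⟩

variable (B) in
/-- The morphism `Θ : (B, ⋆) ⋊ (B, ·) → Aut (B, ⋆)`, `Θ_(a,b)(c) = a ⋆ λ_b(c) ⋆ a^⋆`. -/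
def ThetaHom : SemiProd B →* MulAut (Multiplicative B) :=
  SemidirectProduct.lift MulAut.conj (lam B) (fun b => by
    ext a c
    simp)

/-- `Θ_g(c)` as an element of `B`. -/
def Theta (g : SemiProd B) (c : B) : B := (ThetaHom B g (Multiplicative.ofAdd c)).toAdd

theorem Theta_pair (a b c : B) : Theta (pair a b) c = a + lamFun b c + -a := by
  rfl

theorem Theta_mul (g h : SemiProd B) (c : B) : Theta (g * h) c = Theta g (Theta h c) := by
  simp [Theta]

/-- The stabiliser of `a` for the action `Θ`. -/
def stab (a : B) : Subgroup (SemiProd B) :=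
  (MulAction.stabilizer (MulAut (Multiplicative B)) (Multiplicative.ofAdd a)).comap (ThetaHom B)

theorem mem_stab {a : B} {g : SemiProd B} : g ∈ stab a ↔ Theta g a = a := by
  rw [stab, Subgroup.mem_comap, MulAction.mem_stabilizer_iff]
  rfl

variable (B) in
/-- The set of orbits `B_a = {Θ_(b,c)(a) | b, c ∈ B}` of the action `Θ`. -/
def orbits : Set (Set B) := Set.range fun a : B => Set.range fun g : SemiProd B => Theta g a

variable (B) in
/-- A choice of an element `a_i` in each orbit `i` of the action `Θ`. -/
structure OrbitReps where
  rep : orbits B → B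
  rep_mem : ∀ i : orbits B, rep i ∈ (i : Set B)

/-- If `p : (B, ·) → H` is a surjective group morphism whose kernel lies in the socle of `B`,
then the star operation passes to the quotient: there is a unique operation on `H` with
`p a ⋆ p b = p (a ⋆ b)`, and it makes `H` a skew left brace. -/
theorem compat_of_socle {H : Type*} [Group H] (p : B →* H)
    (hk : ∀ k, p k = 1 → (∀ b : B, lamFun k b = b) ∧ ∀ b : B, b + k = k + b)
    {a a' b b' : B} (ha : p a = p a') (hb : p b = p b') : p (a + b) = p (a' + b') := by
  have key : ∀ c d : B, p c = p d → ∃ m, p m = 1 ∧ d = c + m := by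
    intro c d h
    have h1 : p (c⁻¹ * d) = 1 := by rw [map_mul, map_inv, h, inv_mul_cancel]
    obtain ⟨hl, hc⟩ := hk _ h1
    have h2 : lamFun c (c⁻¹ * d) = c * (c⁻¹ * d) * c⁻¹ := by
      set k := c⁻¹ * d with hkdef
      have e1 : c * k = c + lamFun c k := mul_eq_add_lam c k
      have hk3 : p (c * k * c⁻¹) = 1 := by simp [h1]
      obtain ⟨hl3, hc3⟩ := hk _ hk3
      have e2 : c * k = (c * k * c⁻¹) + c := by
        have := mul_eq_add_lam (c * k * c⁻¹) c
        rw [hl3 c] at this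
        rw [← this]; group
      rw [← hc3] at e2
      exact add_left_cancel (e1.symm.trans e2)
    refine ⟨lamFun c (c⁻¹ * d), ?_, ?_⟩
    · rw [h2, map_mul, map_mul, h1, mul_one, ← map_mul, mul_inv_cancel, map_one]
    · rw [← mul_eq_add_lam]; group
  have key2 : ∀ c m : B, p m = 1 → p (c + m) = p c := by
    intro c m hm
    obtain ⟨hl, hc⟩ := hk _ hm
    rw [hc, ← hl c, ← mul_eq_add_lam, map_mul, hm, one_mul, hl]
  obtain ⟨m, hm, rfl⟩ := key a a' ha
  obtain ⟨n, hn, rfl⟩ := key b b' hb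
  rw [← add_assoc, key2 _ n hn, add_assoc, ← (hk m hm).2, ← add_assoc, key2 _ m hm]

/-- The quotient structure described in `compat_of_socle`. -/
noncomputable abbrev ofSurjective {H : Type*} [Group H] (p : B →* H) (hp : Surjective p)
    (hk : ∀ k, p k = 1 → (∀ b : B, lamFun k b = b) ∧ ∀ b : B, b + k = k + b) :
    SkewLeftBrace H :=
  letI : Add H := ⟨fun x y => p (surjInv hp x + surjInv hp y)⟩
  letI : Zero H := ⟨p 0⟩
  letI : Neg H := ⟨fun x => p (-surjInv hp x)⟩
  have hadd : ∀ a b : B, p a + p b = p (a + b) := fun a b =>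
    compat_of_socle p hk (surjInv_eq hp _) (surjInv_eq hp _)
  have hzero : p 0 = (0 : H) := rfl
  have hneg : ∀ a : B, -p a = p (-a) := fun a => by
    have h := compat_of_socle p hk (a := -a + surjInv hp (p a)) (a' := -a + a)
      (b := -surjInv hp (p a)) (b' := -surjInv hp (p a))
      (compat_of_socle p hk rfl (surjInv_eq hp _)) rfl
    rw [add_assoc, add_neg_cancel, add_zero, neg_add_cancel, zero_add] at h
    exact h.symm
  letI : AddGroup H := AddGroup.ofLeftAxioms
    (fun x y z => by
      obtain ⟨a, rfl⟩ := hp x; obtain ⟨b, rfl⟩ := hp y; obtain ⟨c, rfl⟩ := hp z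
      simp only [hadd, add_assoc])
    (fun x => by
      obtain ⟨a, rfl⟩ := hp x
      rw [← hzero, hadd, zero_add])
    (fun x => by
      obtain ⟨a, rfl⟩ := hp x
      rw [hneg, hadd, neg_add_cancel, hzero])
  { (inferInstance : Group H), (inferInstance : AddGroup H) with
    brace_law := fun x y z => by
      obtain ⟨a, rfl⟩ := hp x; obtain ⟨b, rfl⟩ := hp y; obtain ⟨c, rfl⟩ := hp z
      show p a * (p b + p c) = p a * p b + -p a + p a * p c
      simp only [hadd, hneg, ← map_mul, brace_law] }

end SkewLeftBrace

/-! ### Set-theoretic solutions of the Yang-Baxter equation -/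

/-- `r × id` on `X × X × X`. -/
def braidLeft {X : Type*} (r : X × X → X × X) : X × X × X → X × X × X :=
  fun t => ((r (t.1, t.2.1)).1, (r (t.1, t.2.1)).2, t.2.2)

/-- `id × r` on `X × X × X`. -/
def braidRight {X : Type*} (r : X × X → X × X) : X × X × X → X × X × X :=
  fun t => (t.1, r t.2)

/-- A non-degenerate set-theoretic solution `(X, r)` of the Yang-Baxter equation, where
`r (x, y) = (f_x(y), g_y(x))`. -/
structure NondegSolution (X : Type*) where
  r : X × X → X × X
  nonempty : Nonempty X
  bijective : Bijective r
  braid : braidLeft r ∘ braidRight r ∘ braidLeft r = braidRight r ∘ braidLeft r ∘ braidRight r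
  f_bijective : ∀ x, Bijective fun y => (r (x, y)).1
  g_bijective : ∀ y, Bijective fun x => (r (x, y)).2

namespace NondegSolution

theorem perm_apply_inv {α : Type*} (π : Equiv.Perm α) (x : α) : π (π⁻¹ x) = x :=
  π.apply_symm_apply x

theorem perm_inv_apply {α : Type*} (π : Equiv.Perm α) (x : α) : π⁻¹ (π x) = x :=
  π.symm_apply_apply x

variable {X : Type*} (S : NondegSolution X)

/-- The solution is square-free: `r (x, x) = (x, x)` for all `x`. -/
def SquareFree : Prop := ∀ x, S.r (x, x) = (x, x)

/-- `F` is a morphism of solutions. -/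
def IsMorphism {Y : Type*} (T : NondegSolution Y) (F : X → Y) : Prop :=
  ∀ x y, T.r (F x, F y) = Prod.map F F (S.r (x, y))

/-- The permutation `f_x`. -/
noncomputable def f (x : X) : Equiv.Perm X := Equiv.ofBijective _ (S.f_bijective x)

/-- The permutation `g_y`. -/
noncomputable def g (y : X) : Equiv.Perm X := Equiv.ofBijective _ (S.g_bijective y)

theorem r_eq (x y : X) : S.r (x, y) = (S.f x y, S.g y x) := rfl

theorem r_inj {x y x' y' : X} (h1 : S.f x y = S.f x' y') (h2 : S.g y x = S.g y' x') :
    x = x' ∧ y = y' := by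
  have := S.bijective.1 (a₁ := (x, y)) (a₂ := (x', y')) (by rw [r_eq, r_eq, h1, h2])
  simpa using this

theorem r_surj (u v : X) : ∃ x y, S.f x y = u ∧ S.g y x = v := by
  obtain ⟨⟨x, y⟩, h⟩ := S.bijective.2 (u, v)
  rw [r_eq] at h
  exact ⟨x, y, congrArg Prod.fst h, congrArg Prod.snd h⟩

/-- The permutation `g̃_x(z) = g_{λ_z⁻¹(x)}(z)`, where `λ_z⁻¹(x) = f_z⁻¹(x)` for `x ∈ X`. -/
noncomputable def gTilde (x : X) : Equiv.Perm X :=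
  Equiv.ofBijective (fun z => S.g ((S.f z).symm x) z) (by
    constructor
    · intro z z' h
      exact (S.r_inj (x := z) (y := (S.f z).symm x) (x' := z') (y' := (S.f z').symm x)
        (by simp) h).1
    · intro w
      obtain ⟨a, b, h1, h2⟩ := S.r_surj x w
      exact ⟨a, by simp [← h1, h2]⟩)

/-- The permutation group `𝒢(X, r)`, generated by the pairs `(f_x, g̃_x⁻¹)`. -/
def permGroup : Subgroup (Equiv.Perm X × Equiv.Perm X) :=
  Subgroup.closure (Set.range fun x => (S.f x, (S.gTilde x)⁻¹))

/-! The equations satisfied by `f`, `g` and `g̃`. -/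

theorem braid_apply (x y z : X) :
    S.f (S.f x y) (S.f (S.g y x) z) = S.f x (S.f y z) ∧
    S.g (S.f (S.g y x) z) (S.f x y) = S.f (S.g (S.f y z) x) (S.g z y) ∧
    S.g z (S.g y x) = S.g (S.g z y) (S.g (S.f y z) x) := by
  have h := congrFun S.braid (x, y, z)
  simp only [comp_apply, braidLeft, braidRight, r_eq, Prod.mk.injEq] at h
  exact h

theorem gTilde_inv_r (x y : X) : (S.gTilde (S.f x y))⁻¹ (S.g y x) = x := by
  rw [Equiv.Perm.inv_eq_iff_eq]
  show S.g y x = S.g ((S.f x).symm (S.f x y)) x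
  rw [Equiv.symm_apply_apply]

theorem f_rel (x y : X) : S.f x * S.f y = S.f (S.f x y) * S.f (S.g y x) := by
  ext z
  exact (S.braid_apply x y z).1.symm

theorem gTilde_rel (x y : X) : (S.gTilde x)⁻¹ * (S.gTilde y)⁻¹ =
    (S.gTilde (S.f x y))⁻¹ * (S.gTilde (S.g y x))⁻¹ := by
  ext w
  obtain ⟨b, c, h1, h2⟩ := S.r_surj y w
  obtain ⟨a, d, h3, h4⟩ := S.r_surj x b
  obtain ⟨k1, k2, k3⟩ := S.braid_apply a d c
  rw [h3, h4, h1] at k1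
  rw [h3, h4, h1] at k2
  rw [h4, h2] at k3
  have e1 : (S.gTilde y)⁻¹ w = b := by rw [← h1, ← h2, gTilde_inv_r]
  have e2 : (S.gTilde x)⁻¹ b = a := by rw [← h3, ← h4, gTilde_inv_r]
  have e3 : (S.gTilde (S.g y x))⁻¹ w = S.g (S.f d c) a := by rw [k2, k3, gTilde_inv_r]
  have e4 : (S.gTilde (S.f x y))⁻¹ (S.g (S.f d c) a) = a := by rw [k1, gTilde_inv_r]
  rw [Equiv.Perm.mul_apply, Equiv.Perm.mul_apply, e1, e2, e3, e4]

theorem mixed_rel (z u : X) : S.f z * (S.gTilde u)⁻¹ =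
    (S.gTilde (S.f z u))⁻¹ * S.f (S.g u z) := by
  ext w
  obtain ⟨b, c, h1, h2⟩ := S.r_surj u w
  obtain ⟨k1, k2, k3⟩ := S.braid_apply z b c
  rw [h1] at k1
  rw [h1, h2] at k2
  have e1 : (S.gTilde u)⁻¹ w = b := by rw [← h1, ← h2, gTilde_inv_r]
  have e2 : (S.gTilde (S.f z u))⁻¹ (S.f (S.g u z) w) = S.f z b := by
    rw [← k1, ← k2, gTilde_inv_r]
  rw [Equiv.Perm.mul_apply, Equiv.Perm.mul_apply, e1, e2]

/-- The permutation `x ↦ x ◁ u = f_u g̃_u(x)`; in the derived group `x ⋆ u = u ⋆ (x ◁ u)`. -/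
noncomputable def der (u : X) : Equiv.Perm X := S.f u * S.gTilde u

theorem der_f (x y : X) : S.der (S.f x y) x = S.f (S.f x y) (S.g y x) := by
  have := S.gTilde_inv_r x y
  rw [Equiv.Perm.inv_eq_iff_eq] at this
  rw [der, Equiv.Perm.mul_apply, ← this]

theorem f_der (z u : X) : S.f z * S.der u = S.der (S.f z u) * S.f z := by
  have h1 := S.f_rel z u
  have h2 := S.mixed_rel z u
  have h3 : S.f (S.g u z) * S.gTilde u = S.gTilde (S.f z u) * S.f z := by
    rw [← inv_mul_eq_iff_eq_mul, ← mul_assoc, ← h2, inv_mul_cancel_right]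
  simp only [der]
  rw [← mul_assoc, h1, mul_assoc, mul_assoc, h3]

/-- The map `z ↦ f_z⁻¹(z)` is bijective. -/
theorem diag_bijective : Bijective fun z => (S.f z).symm z := by
  have key : ∀ y z, S.f y z = y → S.g z y = S.der z z := by
    intro y z h
    have h1 := S.der_f y z
    have h2 := congrArg (fun p => p z) (S.f_der y z)
    simp only [Equiv.Perm.mul_apply] at h2
    rw [h] at h1 h2
    rw [← h2] at h1
    exact ((S.f y).injective h1).symm
  constructor
  · intro y y' h
    simp only at h
    have hy : S.f y ((S.f y).symm y) = y := by simp
    have hy' : S.f y' ((S.f y').symm y') = y' := by simp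
    rw [h] at hy
    have e1 := key _ _ hy
    have e2 := key _ _ hy'
    exact (S.g _).injective (e1.trans e2.symm)
  · intro z
    set t := (S.f z).symm z with ht
    have hzt : S.f z t = z := by simp [ht]
    set v := S.g t z with hv
    have hw : S.f z v = S.der z z := by
      have := S.der_f z t
      rw [hzt] at this
      exact this.symm
    have hft : S.f t = S.f v := by
      have := S.f_rel z t
      rw [hzt] at this
      exact mul_left_cancel this
    have hgt : S.g t = S.g v := by
      ext x
      obtain ⟨-, -, k⟩ := S.braid_apply ((S.g z).symm x) z t
      rw [hzt, ← hv] at k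
      simpa using k
    have hfw : S.f (S.der z z) = S.f z := by
      have e1 := S.f_rel z v
      have e2 := S.f_rel z t
      rw [hzt, ← hv] at e2
      rw [hw, ← hgt, ← hv, ← hft] at e1
      exact (mul_right_cancel e1).symm
    set y := (S.g z).symm (S.der z z) with hy
    have hgy : S.g z y = S.der z z := by simp [hy]
    refine ⟨y, ?_⟩
    have hfy : S.f y = S.f (S.f y z) := by
      have := S.f_rel y z
      rw [hgy, hfw] at this
      exact mul_right_cancel this
    have h1 := S.der_f y z
    have h2 := congrArg (fun p => p z) (S.f_der (S.f y z) z)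
    simp only [Equiv.Perm.mul_apply] at h2
    rw [hgy, h2, ← hfy] at h1
    have h3 := (S.der (S.f y z)).injective h1
    simp only
    rw [Equiv.symm_apply_eq]
    exact h3

/-! ### The structure group, the derived group and their skew left brace structure -/

/-- The structure group `G(X, r)`, with generators `X` and relations `x · y = f_x(y) · g_y(x)`. -/
abbrev StructGroup : Type _ := PresentedGroup
  {w | ∃ x y : X, w = (FreeGroup.of x * FreeGroup.of y) *
    (FreeGroup.of (S.f x y) * FreeGroup.of (S.g y x))⁻¹}

/-- The derived group `A(X, r)`, with generators `X` and relations
`x ⋆ f_x(y) = f_x(y) ⋆ f_{f_x(y)} g_y(x)`. -/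
abbrev DerGroup : Type _ := PresentedGroup
  {w | ∃ x y : X, w = (FreeGroup.of x * FreeGroup.of (S.f x y)) *
    (FreeGroup.of (S.f x y) * FreeGroup.of (S.f (S.f x y) (S.g y x)))⁻¹}

/-- The natural map `X → G(X, r)`. -/
def iG (x : X) : S.StructGroup := PresentedGroup.of x

/-- The natural map `X → A(X, r)`. -/
def iA (x : X) : S.DerGroup := PresentedGroup.of x

section lifts
variable {H : Type*} [Group H]

def liftG (F : X → H) (hF : ∀ x y, F x * F y = F (S.f x y) * F (S.g y x)) :
    S.StructGroup →* H :=
  PresentedGroup.toGroup (f := F) (by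
    rintro _ ⟨x, y, rfl⟩
    simp only [map_mul, map_inv, FreeGroup.lift_apply_of]
    rw [hF, mul_inv_cancel])

theorem liftG_iG (F : X → H) (hF) (x : X) : S.liftG F hF (S.iG x) = F x :=
  PresentedGroup.toGroup.of _

def liftA (F : X → H) (hF : ∀ x u, F x * F u = F u * F (S.der u x)) : S.DerGroup →* H :=
  PresentedGroup.toGroup (f := F) (by
    rintro _ ⟨x, y, rfl⟩
    simp only [map_mul, map_inv, FreeGroup.lift_apply_of]
    rw [hF, der_f, mul_inv_cancel])

theorem liftA_iA (F : X → H) (hF) (x : X) : S.liftA F hF (S.iA x) = F x :=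
  PresentedGroup.toGroup.of _

end lifts

theorem iG_rel (x y : X) : S.iG x * S.iG y = S.iG (S.f x y) * S.iG (S.g y x) := by
  rw [← mul_inv_eq_one]
  have : PresentedGroup.mk {w | ∃ x y : X, w = (FreeGroup.of x * FreeGroup.of y) *
    (FreeGroup.of (S.f x y) * FreeGroup.of (S.g y x))⁻¹}
    ((FreeGroup.of x * FreeGroup.of y) *
      (FreeGroup.of (S.f x y) * FreeGroup.of (S.g y x))⁻¹) = 1 :=
    PresentedGroup.one_of_mem ⟨x, y, rfl⟩
  exact this

theorem iA_rel (x u : X) : S.iA x * S.iA u = S.iA u * S.iA (S.der u x) := by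
  obtain ⟨y, rfl⟩ := (S.f x).surjective u
  rw [← mul_inv_eq_one, der_f]
  have : PresentedGroup.mk {w | ∃ x y : X, w = (FreeGroup.of x * FreeGroup.of (S.f x y)) *
    (FreeGroup.of (S.f x y) * FreeGroup.of (S.f (S.f x y) (S.g y x)))⁻¹}
    ((FreeGroup.of x * FreeGroup.of (S.f x y)) *
      (FreeGroup.of (S.f x y) * FreeGroup.of (S.f (S.f x y) (S.g y x)))⁻¹) = 1 :=
    PresentedGroup.one_of_mem ⟨x, y, rfl⟩
  exact this

theorem closure_iG : Subgroup.closure (Set.range S.iG) = ⊤ := PresentedGroup.closure_range_of _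

theorem closure_iA : Subgroup.closure (Set.range S.iA) = ⊤ := PresentedGroup.closure_range_of _

theorem homA_ext {H : Type*} [Group H] {p q : S.DerGroup →* H}
    (h : ∀ x, p (S.iA x) = q (S.iA x)) : p = q := PresentedGroup.ext h

/-- The action `f : G(X, r) → Sym_X`. -/
noncomputable def fHom : S.StructGroup →* Equiv.Perm X := S.liftG S.f S.f_rel

/-- The morphism `b ↦ g̃_b⁻¹` from `G(X, r)` to `Sym_X`. -/
noncomputable def gTildeInvHom : S.StructGroup →* Equiv.Perm X :=
  S.liftG (fun x => (S.gTilde x)⁻¹) S.gTilde_rel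

/-- The automorphism of `A(X, r)` induced by a permutation that respects the relations. -/
def autA (π : Equiv.Perm X) (hπ : ∀ u, π * S.der u = S.der (π u) * π) : MulAut S.DerGroup :=
  MonoidHom.toMulEquiv
    (S.liftA (fun x => S.iA (π x)) (fun x u => by
      rw [iA_rel, ← Equiv.Perm.mul_apply, ← hπ]; rfl))
    (S.liftA (fun x => S.iA (π⁻¹ x)) (fun x u => by
      rw [iA_rel]
      have h := congrArg (fun p => p (π⁻¹ x)) (hπ (π⁻¹ u))
      simp only [Equiv.Perm.mul_apply] at h
      rw [perm_apply_inv, perm_apply_inv] at h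
      rw [← h, perm_inv_apply]))
    (S.homA_ext (fun x => by simp [liftA_iA]))
    (S.homA_ext (fun x => by simp [liftA_iA]))

theorem autA_iA (π : Equiv.Perm X) (hπ) (x : X) : S.autA π hπ (S.iA x) = S.iA (π x) :=
  S.liftA_iA (fun x => S.iA (π x)) (fun x u => by
    rw [iA_rel, ← Equiv.Perm.mul_apply, ← hπ]; rfl) x

theorem autA_mul (π ρ : Equiv.Perm X) (hπ hρ h) :
    S.autA (π * ρ) h = S.autA π hπ * S.autA ρ hρ := by
  have : (S.autA (π * ρ) h).toMonoidHom = (S.autA π hπ * S.autA ρ hρ).toMonoidHom :=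
    S.homA_ext (fun x => by
      show S.autA (π * ρ) h (S.iA x) = S.autA π hπ (S.autA ρ hρ (S.iA x))
      simp only [autA_iA, Equiv.Perm.mul_apply])
  ext a
  exact DFunLike.congr_fun this a

/-- The action `λ : G(X, r) → Aut (A(X, r))`, `λ_{i(x)}(i(y)) = i(f_x(y))`. -/
noncomputable def lamA : S.StructGroup →* MulAut S.DerGroup :=
  S.liftG (fun x => S.autA (S.f x) (S.f_der x)) (fun x y => by
    have hc : ∀ u, (S.f x * S.f y) * S.der u
        = S.der ((S.f x * S.f y) u) * (S.f x * S.f y) := fun u => by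
      rw [mul_assoc, S.f_der y u, ← mul_assoc, S.f_der x, mul_assoc]; rfl
    have hd : ∀ u, (S.f (S.f x y) * S.f (S.g y x)) * S.der u
        = S.der ((S.f (S.f x y) * S.f (S.g y x)) u) * (S.f (S.f x y) * S.f (S.g y x)) := by
      rw [← f_rel]; exact hc
    rw [← S.autA_mul _ _ _ _ hc, ← S.autA_mul _ _ _ _ hd]
    congr 1
    exact S.f_rel x y)

theorem fHom_iG (x : X) : S.fHom (S.iG x) = S.f x := S.liftG_iG _ _ x

theorem gTildeInvHom_iG (x : X) : S.gTildeInvHom (S.iG x) = (S.gTilde x)⁻¹ := S.liftG_iG _ _ x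

theorem lamA_iG (x y : X) : S.lamA (S.iG x) (S.iA y) = S.iA (S.f x y) := by
  rw [lamA, liftG_iG, autA_iA]

theorem G_induction {P : S.StructGroup → Prop} (one : P 1)
    (mul : ∀ b c, P b → P c → P (b * c)) (inv : ∀ b, P b → P b⁻¹) (gen : ∀ x, P (S.iG x))
    (b : S.StructGroup) : P b := by
  have hb : b ∈ Subgroup.closure (Set.range S.iG) := by rw [closure_iG]; trivial
  induction hb using Subgroup.closure_induction with
  | mem x hx => obtain ⟨y, rfl⟩ := hx; exact gen y
  | one => exact one
  | mul b c _ _ hb hc => exact mul b c hb hc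
  | inv b _ hb => exact inv b hb

theorem A_induction {P : S.DerGroup → Prop} (one : P 1)
    (mul : ∀ b c, P b → P c → P (b * c)) (inv : ∀ b, P b → P b⁻¹) (gen : ∀ x, P (S.iA x))
    (b : S.DerGroup) : P b := by
  have hb : b ∈ Subgroup.closure (Set.range S.iA) := by rw [closure_iA]; trivial
  induction hb using Subgroup.closure_induction with
  | mem x hx => obtain ⟨y, rfl⟩ := hx; exact gen y
  | one => exact one
  | mul b c _ _ hb hc => exact mul b c hb hc
  | inv b _ hb => exact inv b hb

theorem lamA_iA (b : S.StructGroup) (y : X) : S.lamA b (S.iA y) = S.iA (S.fHom b y) := by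
  revert y
  induction b using S.G_induction with
  | one => intro y; simp
  | mul b c hb hc => intro y; simp [hb, hc]
  | inv b hb =>
    intro y
    rw [map_inv, map_inv, MulAut.inv_apply, MulEquiv.symm_apply_eq, hb]
    simp
  | gen x => intro y; rw [lamA_iG, fHom_iG]

/-- The morphism `G(X, r) → A(X, r) ⋊ G(X, r)` with `i(x) ↦ (i(x), i(x))`. -/
noncomputable def graphHom : S.StructGroup →* SemidirectProduct S.DerGroup S.StructGroup S.lamA :=
  S.liftG (fun x => ⟨S.iA x, S.iG x⟩) (fun x y => by
    apply SemidirectProduct.ext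
    · simp only [SemidirectProduct.mul_left, lamA_iG]
      rw [iA_rel, der_f]
    · exact S.iG_rel x y)

/-- The bijective cocycle `φ : G(X, r) → A(X, r)` with `φ(i(x)) = i(x)` and
`φ(b · c) = φ(b) ⋆ λ_b(φ(c))`. -/
noncomputable def phi (b : S.StructGroup) : S.DerGroup := (S.graphHom b).left

theorem graphHom_right (b : S.StructGroup) : (S.graphHom b).right = b := by
  have : (SemidirectProduct.rightHom.comp S.graphHom) = MonoidHom.id S.StructGroup :=
    PresentedGroup.ext (fun x => by
      show (S.graphHom (S.iG x)).right = S.iG x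
      rw [graphHom, liftG_iG])
  exact DFunLike.congr_fun this b

theorem phi_iG (x : X) : S.phi (S.iG x) = S.iA x := by rw [phi, graphHom, liftG_iG]

theorem phi_mul (b c : S.StructGroup) : S.phi (b * c) = S.phi b * S.lamA b (S.phi c) := by
  simp [phi, graphHom_right]

theorem phi_one : S.phi 1 = 1 := by simp [phi]

/-- The permutation `b ↦ b ⋆ i(x) = b · i(f_b⁻¹(x))` of `G(X, r)`. -/
noncomputable def rightStar (x : X) : Equiv.Perm S.StructGroup :=
  Equiv.ofBijective (fun b => b * S.iG ((S.fHom b).symm x)) (by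
    have hf : ∀ b z, S.fHom (b * S.iG z) = S.fHom b * S.f z := fun b z => by
      rw [map_mul, fHom_iG]
    constructor
    · intro b b' h
      simp only at h
      have hz : ∀ c, (S.fHom (c * S.iG ((S.fHom c).symm x))).symm x
          = (S.f ((S.fHom c).symm x)).symm ((S.fHom c).symm x) := fun c => by
        rw [hf]; rfl
      have e : (S.fHom b).symm x = (S.fHom b').symm x := by
        apply S.diag_bijective.1
        simp only
        rw [← hz, ← hz, h]
      rw [e] at h
      exact mul_right_cancel h
    · intro w
      obtain ⟨z, hz⟩ := S.diag_bijective.2 ((S.fHom w).symm x)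
      simp only at hz
      refine ⟨w * (S.iG z)⁻¹, ?_⟩
      have : (S.fHom (w * (S.iG z)⁻¹)).symm x = z := by
        rw [Equiv.symm_apply_eq, map_mul, map_inv, fHom_iG, Equiv.Perm.mul_apply]
        have h2 : (S.f z)⁻¹ z = (S.fHom w).symm x := hz
        rw [h2, Equiv.apply_symm_apply]
      simp only [this]
      group)

theorem rightStar_apply (x : X) (b : S.StructGroup) :
    S.rightStar x b = b * S.iG ((S.fHom b).symm x) := rfl

theorem rightStar_rel (x u : X) :
    S.rightStar u * S.rightStar x = S.rightStar (S.der u x) * S.rightStar u := by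
  ext b
  simp only [Equiv.Perm.mul_apply, rightStar_apply, map_mul, fHom_iG]
  set β := S.fHom b
  have hβ : β.symm (S.der u x) = S.der (β.symm u) (β.symm x) := by
    have hgen : ∀ (c : S.StructGroup) (v : X),
        S.fHom c * S.der v = S.der (S.fHom c v) * S.fHom c := by
      intro c
      induction c using S.G_induction with
      | one => intro v; simp
      | mul b c hb hc =>
        intro v
        rw [map_mul, mul_assoc, hc, ← mul_assoc, hb, mul_assoc]; rfl
      | inv b hb =>
        intro v
        have := hb ((S.fHom b)⁻¹ v)
        rw [perm_apply_inv] at this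
        rw [map_inv, inv_mul_eq_iff_eq_mul, ← mul_assoc, this, mul_assoc, mul_inv_cancel, mul_one]
      | gen x => intro v; rw [fHom_iG, f_der]
    rw [Equiv.symm_apply_eq, ← Equiv.Perm.mul_apply, hgen b]
    simp [β]
  have e1 : (β * S.f (β.symm x)).symm u = (S.f (β.symm x)).symm (β.symm u) := rfl
  have e2 : (β * S.f (β.symm u)).symm (S.der u x)
      = (S.f (β.symm u)).symm (β.symm (S.der u x)) := rfl
  rw [e1, e2, hβ]
  set x' := β.symm x
  obtain ⟨y, hy⟩ := (S.f x').surjective (β.symm u)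
  rw [← hy, der_f, Equiv.symm_apply_apply, Equiv.symm_apply_apply, mul_assoc, mul_assoc, iG_rel]

/-- The action of `A(X, r)` on `G(X, r)` given by right star multiplication by the inverse. -/
noncomputable def starAct : S.DerGroup →* Equiv.Perm S.StructGroup :=
  S.liftA (fun x => (S.rightStar x)⁻¹) (fun x u => by
    rw [← mul_inv_rev, ← mul_inv_rev, rightStar_rel])

theorem starAct_iA_inv (x : X) : (S.starAct (S.iA x))⁻¹ = S.rightStar x := by
  rw [starAct, liftA_iA, inv_inv]

theorem phi_rightStar (x : X) (b : S.StructGroup) : S.phi (S.rightStar x b) = S.phi b * S.iA x := by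
  rw [rightStar_apply, phi_mul, phi_iG, lamA_iA, Equiv.apply_symm_apply]

theorem phi_starAct (a : S.DerGroup) : ∀ b, S.phi ((S.starAct a)⁻¹ b) = S.phi b * a := by
  induction a using S.A_induction with
  | one => intro b; simp
  | mul a c ha hc =>
    intro b
    rw [map_mul, mul_inv_rev, Equiv.Perm.mul_apply, hc, ha, mul_assoc]
  | inv a ha =>
    intro b
    have := ha (S.starAct a b)
    rw [perm_inv_apply] at this
    rw [map_inv, inv_inv, this, mul_inv_cancel_right]
  | gen x => intro b; rw [starAct_iA_inv, phi_rightStar]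

theorem starAct_lamA (b : S.StructGroup) (a : S.DerGroup) :
    ∀ c, (S.starAct (S.lamA b a))⁻¹ (b * c) = b * (S.starAct a)⁻¹ c := by
  induction a using S.A_induction with
  | one => intro c; simp
  | mul a d ha hd =>
    intro c
    have e1 : (S.starAct (S.lamA b (a * d)))⁻¹
        = (S.starAct (S.lamA b d))⁻¹ * (S.starAct (S.lamA b a))⁻¹ := by
      rw [map_mul, map_mul, mul_inv_rev]
    have e2 : (S.starAct (a * d))⁻¹ = (S.starAct d)⁻¹ * (S.starAct a)⁻¹ := by
      rw [map_mul, mul_inv_rev]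
    rw [e1, e2, Equiv.Perm.mul_apply, Equiv.Perm.mul_apply, ha, hd]
  | inv a ha =>
    intro c
    have := ha (S.starAct a c)
    rw [perm_inv_apply, Equiv.Perm.inv_eq_iff_eq] at this
    rw [map_inv, map_inv, map_inv, inv_inv, inv_inv, this]
  | gen x =>
    intro c
    rw [lamA_iA, starAct_iA_inv, starAct_iA_inv, rightStar_apply, rightStar_apply, mul_assoc]
    congr 3
    rw [Equiv.symm_apply_eq, map_mul, Equiv.Perm.mul_apply, Equiv.apply_symm_apply]

theorem starAct_phi (b : S.StructGroup) : (S.starAct (S.phi b))⁻¹ 1 = b := by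
  induction b using S.G_induction with
  | one => simp [phi_one]
  | mul b c hb hc =>
    rw [phi_mul, map_mul, mul_inv_rev, Equiv.Perm.mul_apply, hb]
    have := S.starAct_lamA b (S.phi c) 1
    rw [mul_one, hc] at this
    exact this
  | inv b hb =>
    have h1 : S.phi b⁻¹ = (S.lamA b⁻¹ (S.phi b))⁻¹ := by
      have := S.phi_mul b⁻¹ b
      rw [inv_mul_cancel, phi_one] at this
      exact eq_inv_of_mul_eq_one_left this.symm
    have h2 := S.starAct_lamA b⁻¹ (S.phi b) 1
    rw [hb, mul_one, inv_mul_cancel, Equiv.Perm.inv_eq_iff_eq] at h2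
    rw [h1, map_inv, inv_inv]
    exact h2.symm
  | gen x => rw [phi_iG, starAct_iA_inv, rightStar_apply, one_mul, map_one]; rfl

/-- The bijection `φ : G(X, r) → A(X, r)`. -/
noncomputable def phiEquiv : S.StructGroup ≃ S.DerGroup where
  toFun := S.phi
  invFun a := (S.starAct a)⁻¹ 1
  left_inv := S.starAct_phi
  right_inv a := by rw [phi_starAct, phi_one, one_mul]

/-- The skew left brace structure of `G(X, r)`: the star operation is transported from `A(X, r)`
along `φ`, that is, `φ(b ⋆ c) = φ(b) ⋆ φ(c)`. -/
noncomputable instance structBrace : SkewLeftBrace S.StructGroup :=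
  letI : AddGroup S.StructGroup :=
    (S.phiEquiv.trans (Additive.ofMul : S.DerGroup ≃ Additive S.DerGroup)).addGroup
  { (inferInstance : Group S.StructGroup), (inferInstance : AddGroup S.StructGroup) with
    brace_law := fun a b c => by
      apply S.phiEquiv.injective
      have hadd : ∀ b c : S.StructGroup, S.phi (b + c) = S.phi b * S.phi c := fun b c =>
        S.phiEquiv.apply_symm_apply _
      have hneg : ∀ b : S.StructGroup, S.phi (-b) = (S.phi b)⁻¹ := fun b =>
        S.phiEquiv.apply_symm_apply _
      show S.phi (a * (b + c)) = S.phi (a * b + -a + a * c)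
      rw [hadd, hadd, hneg, phi_mul, phi_mul, phi_mul, hadd, map_mul]
      group }

theorem phi_add (b c : S.StructGroup) : S.phi (b + c) = S.phi b * S.phi c :=
  S.phiEquiv.apply_symm_apply _

theorem phi_neg (b : S.StructGroup) : S.phi (-b) = (S.phi b)⁻¹ :=
  S.phiEquiv.apply_symm_apply _

theorem phi_lamFun (b c : S.StructGroup) :
    S.phi (SkewLeftBrace.lamFun b c) = S.lamA b (S.phi c) := by
  rw [SkewLeftBrace.lamFun, phi_add, phi_neg, phi_mul, inv_mul_cancel_left]

/-! ### The skew left brace structure of the permutation group -/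

/-- The surjective morphism `G(X, r) → 𝒢(X, r)`, `b ↦ (f_b, g̃_b⁻¹)`. -/
noncomputable def toPerm : S.StructGroup →* S.permGroup :=
  (S.fHom.prod S.gTildeInvHom).codRestrict S.permGroup (fun b => by
    induction b using S.G_induction with
    | one => rw [map_one]; exact one_mem _
    | mul b c hb hc => rw [map_mul]; exact mul_mem hb hc
    | inv b hb => rw [map_inv]; exact inv_mem hb
    | gen x =>
      apply Subgroup.subset_closure
      exact ⟨x, by simp [fHom_iG, gTildeInvHom_iG]⟩)

theorem toPerm_iG (x : X) :
    (S.toPerm (S.iG x) : Equiv.Perm X × Equiv.Perm X) = (S.f x, (S.gTilde x)⁻¹) := by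
  show (S.fHom (S.iG x), S.gTildeInvHom (S.iG x)) = _
  rw [fHom_iG, gTildeInvHom_iG]

theorem toPerm_surjective : Surjective S.toPerm := by
  rintro ⟨c, hc⟩
  induction hc using Subgroup.closure_induction with
  | mem c hc =>
    obtain ⟨x, rfl⟩ := hc
    exact ⟨S.iG x, Subtype.ext (S.toPerm_iG x)⟩
  | one => exact ⟨1, map_one _⟩
  | mul a b _ _ ha hb =>
    obtain ⟨a', ha⟩ := ha
    obtain ⟨b', hb⟩ := hb
    exact ⟨a' * b', by rw [map_mul, ha, hb]; rfl⟩
  | inv a _ ha =>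
    obtain ⟨a', ha⟩ := ha
    exact ⟨a'⁻¹, by rw [map_inv, ha]; rfl⟩

theorem iA_gTildeInv (b : S.StructGroup) : ∀ z : X,
    S.iA (S.gTildeInvHom b z) * S.phi b = S.phi b * S.iA (S.fHom b z) := by
  induction b using S.G_induction with
  | one => intro z; simp [phi_one]
  | mul b c hb hc =>
    intro z
    have h := congrArg (S.lamA b) (hc z)
    rw [map_mul, map_mul, lamA_iA, lamA_iA] at h
    rw [map_mul, map_mul, phi_mul, Equiv.Perm.mul_apply, Equiv.Perm.mul_apply, ← mul_assoc, hb,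
      mul_assoc, h, mul_assoc]
  | inv b hb =>
    intro z
    have h1 : S.lamA b (S.phi b⁻¹) = (S.phi b)⁻¹ := by
      have := S.phi_mul b b⁻¹
      rw [mul_inv_cancel, phi_one] at this
      exact eq_inv_of_mul_eq_one_right this.symm
    apply (S.lamA b).injective
    rw [map_mul, map_mul, h1, lamA_iA, lamA_iA, map_inv, map_inv, perm_apply_inv]
    have h2 := hb ((S.gTildeInvHom b)⁻¹ z)
    rw [perm_apply_inv] at h2
    rw [mul_inv_eq_iff_eq_mul, mul_assoc, h2, inv_mul_cancel_left]
  | gen x =>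
    intro z
    rw [gTildeInvHom_iG, phi_iG, fHom_iG, iA_rel]
    simp [der]

theorem toPerm_ker (k : S.StructGroup) (hk : S.toPerm k = 1) :
    (∀ b : S.StructGroup, SkewLeftBrace.lamFun k b = b) ∧ ∀ b : S.StructGroup, b + k = k + b := by
  have hf : S.fHom k = 1 := congrArg (fun p : S.permGroup => (p : Equiv.Perm X × Equiv.Perm X).1) hk
  have hg : S.gTildeInvHom k = 1 := congrArg (fun p : S.permGroup => (p : Equiv.Perm X × Equiv.Perm X).2) hk
  constructor
  · intro b
    apply S.phiEquiv.injective
    show S.phi _ = S.phi b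
    rw [phi_lamFun]
    have : (S.lamA k).toMonoidHom = MonoidHom.id S.DerGroup := S.homA_ext (fun x => by
      show S.lamA k (S.iA x) = S.iA x
      rw [lamA_iA, hf]; rfl)
    exact DFunLike.congr_fun this _
  · intro b
    apply S.phiEquiv.injective
    show S.phi _ = S.phi _
    rw [phi_add, phi_add]
    have hx : ∀ x, S.iA x * S.phi k = S.phi k * S.iA x := fun x => by
      have := S.iA_gTildeInv k x
      rwa [hf, hg] at this
    generalize S.phi b = a
    induction a using S.A_induction with
    | one => simp
    | mul a c ha hc => rw [mul_assoc, hc, ← mul_assoc, ha, mul_assoc]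
    | inv a ha => rw [inv_mul_eq_iff_eq_mul, ← mul_assoc, ha, mul_inv_cancel_right]
    | gen x => exact hx x

/-- The skew left brace structure of `𝒢(X, r)`: its group structure is that of a subgroup of
`Sym_X × Sym_X`, and its star operation is the one induced from `G(X, r)` along the surjective
morphism `b ↦ (f_b, g̃_b⁻¹)`. -/
noncomputable instance permBrace : SkewLeftBrace S.permGroup :=
  SkewLeftBrace.ofSurjective S.toPerm S.toPerm_surjective S.toPerm_ker

theorem toPerm_add (b c : S.StructGroup) : S.toPerm (b + c) = S.toPerm b + S.toPerm c :=
  SkewLeftBrace.compat_of_socle S.toPerm S.toPerm_ker (surjInv_eq S.toPerm_surjective _).symm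
    (surjInv_eq S.toPerm_surjective _).symm

end NondegSolution

/-! ### The construction of solutions from a skew left brace -/

open SkewLeftBrace

/-- The data `I`, `(J_i)`, `(K_{i,j})` from which a solution is built, for a skew left brace `B`
and a choice of representatives `a_i` of the orbits of `Θ`. -/
structure ConstrData {B : Type u} [SkewLeftBrace B] (a : OrbitReps B) where
  /-- the set `I` of orbits -/
  I : Set (orbits B)
  I_nonempty : I.Nonempty
  /-- the union of the orbits in `I` generates `(B, ⋆)` -/
  generates : AddSubgroup.closure (⋃ i ∈ I, (i : Set B)) = ⊤
  /-- the index sets `J_i` -/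
  J : I → Type v
  J_nonempty : ∀ i, Nonempty (J i)
  /-- the subgroups `K_{i,j}` -/
  K : ∀ i, J i → Subgroup (SemiProd B)
  K_le : ∀ i j, K i j ≤ stab (a.rep i)
  core_trivial : {b : B | pair 1 b ∈ (⨅ i, ⨅ j, (K i j).normalCore) ∧
    pair b b ∈ (⨅ i, ⨅ j, (K i j).normalCore)} = {1}

namespace ConstrData

variable {B : Type*} [SkewLeftBrace B] {a : OrbitReps B} (D : ConstrData a)

/-- The set `X`, the disjoint union of the sets of left cosets of the `K_{i,j}`. -/
abbrev X : Type _ := Σ i : D.I, Σ j : D.J i, SemiProd B ⧸ D.K i j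

/-- The element `(b, c) K_{i,j}` of `X`, for `g = (b, c)`. -/
def coset (i : D.I) (j : D.J i) (g : SemiProd B) : D.X := ⟨i, j, (g : SemiProd B ⧸ D.K i j)⟩

/-- The map `X → B`, `(b, c) K_{i,j} ↦ Θ_(b,c)(a_i)`. -/
def eta (x : D.X) : B :=
  Quotient.liftOn' x.2.2 (fun g => Theta g (a.rep x.1)) (fun g h hgh => by
    have hm := mem_stab.mp (D.K_le _ _ (QuotientGroup.leftRel_apply.mp hgh))
    have := congrArg (Theta g) hm
    rw [← Theta_mul, mul_inv_cancel_left] at this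
    exact this.symm)

theorem eta_coset (i : D.I) (j : D.J i) (g : SemiProd B) :
    D.eta (D.coset i j g) = Theta g (a.rep i) := rfl

/-- Left multiplication of `(B, ⋆) ⋊ (B, ·)` on cosets. -/
def act (g : SemiProd B) (x : D.X) : D.X := ⟨x.1, x.2.1, g • x.2.2⟩

theorem act_coset (g h : SemiProd B) (i : D.I) (j : D.J i) :
    D.act g (D.coset i j h) = D.coset i j (g * h) := rfl

/-- The map `r(x, y) = (f_x(y), g_y(x))`, where for `x = (b₁, c₁) K_{i₁,j₁}` and
`y = (b₂, c₂) K_{i₂,j₂}`, `f_x(y) = (1, Θ_(b₁,c₁)(a_{i₁})) · y` and `g_y(x) = (d, d)⁻¹ · x`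
with `d = Θ_(1, Θ_(b₁,c₁)(a_{i₁})) Θ_(b₂,c₂)(a_{i₂})`. -/
def r (p : D.X × D.X) : D.X × D.X :=
  (D.act (pair 1 (D.eta p.1)) p.2,
    D.act (pair (Theta (pair 1 (D.eta p.1)) (D.eta p.2))
      (Theta (pair 1 (D.eta p.1)) (D.eta p.2)))⁻¹ p.1)

/-- The two conditions: `(1, Θ_(b,c)(a_i))` and `(Θ_(b,c)(a_i), Θ_(b,c)(a_i))` lie in
`(b, c) K_{i,j} (b, c)⁻¹` for all `b, c, i, j`. -/
def SquareFreeConditions : Prop :=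
  ∀ (b c : B) (i : D.I) (j : D.J i),
    pair 1 (Theta (pair b c) (a.rep i)) ∈
      (D.K i j).map (MulAut.conj (pair b c)).toMonoidHom ∧
    pair (Theta (pair b c) (a.rep i)) (Theta (pair b c) (a.rep i)) ∈
      (D.K i j).map (MulAut.conj (pair b c)).toMonoidHom

end ConstrData

/-! Let `G` be the semidirect product. The data `I`, `J`, `K` encode a `G`-set `X` with a
`G`-equivariant map `η : X → B`, given by `(b,c)K ↦ Θ_(b,c)(a_i)`, whose image generates `(B, ⋆)`
and such that only `b = 1` makes both `(1,b)` and `(b,b)` act trivially. The maps `b ↦ (1,b)` and `b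
↦ (b,b)` are morphisms from `(B, ·)` to `G`, and the construction says that `f_x` is the action of
`(1, η x)` and `g̃_x⁻¹` the action of `(η x, η x)`.

From data to solution: the identity `η x · η y = η (f_x y) · η (g_y x)` (`lamFun_mul_Theta_inv`)
yields the braid equation and extends `η` to a morphism from the structure group onto `B`. This
morphism is also additive (`map_add_of_map_f`), and composing it with the injection `b ↦ ((1,b),
(b,b))` into pairs of permutations gives `toPerm`; hence `𝒢(X, r) ≅ B`.

From solution to data: if `b` corresponds to the pair `(π, ρ)`, then `(1,b)` must act as `π` and
`(b,b)` as `ρ`, so `(b,1)` must act as `ρ π⁻¹`. The essential point is that `b ↦ ρ π⁻¹` turns `⋆`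
into composition (`permSnd_mul_permFst_inv_add`). Decomposing the resulting `G`-set into orbits,
with base points lying over the `a_i`, recovers the data (`ConstrData.exists_equiv_of_action`).

In both directions the two conditions on `K` say that `(1, η x)` and `(η x, η x)` fix `x`, which is
square-freeness: the stabiliser of `gK` is `gKg⁻¹`. -/

namespace SkewLeftBrace

/-! ### Identities in a skew left brace and in its semidirect product -/

variable {B : Type*} [SkewLeftBrace B]

theorem lamFun_inv_lamFun (b c : B) : lamFun b⁻¹ (lamFun b c) = c := by
  rw [← lamFun_mul, inv_mul_cancel, lamFun_one]

theorem lamFun_lamFun_inv (b c : B) : lamFun b (lamFun b⁻¹ c) = c := by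
  rw [← lamFun_mul, mul_inv_cancel, lamFun_one]

theorem lamFun_right_one (b : B) : lamFun b (1 : B) = 1 := by
  rw [lamFun, mul_one, neg_add_cancel, one_eq_zero]

theorem neg_eq_inv_lamFun (b : B) : -b = (lamFun (-b)⁻¹ b)⁻¹ := by
  rw [eq_inv_iff_mul_eq_one, mul_eq_add_lam, lamFun_lamFun_inv, neg_add_cancel, one_eq_zero]

/-- A subset that is stable under `λ` and generates the star group generates the multiplicative
group. -/
theorem closure_eq_top_of_addClosure {E : Set B} (hE : ∀ b, ∀ e ∈ E, lamFun b e ∈ E)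
    (h : AddSubgroup.closure E = ⊤) : Subgroup.closure E = ⊤ := by
  rw [eq_top_iff]
  rintro b -
  have hb : b ∈ AddSubgroup.closure E := h ▸ AddSubgroup.mem_top b
  induction hb using AddSubgroup.closure_induction_right with
  | zero => rw [← one_eq_zero]; exact one_mem _
  | add_right x _ y hy ih =>
    -- Adding a generator on the right is multiplying on the right by its translate under `λ`, which
    -- is again in `E`; inverses need a second translate.
    have e : x + y = x * lamFun x⁻¹ y := by rw [mul_eq_add_lam, lamFun_lamFun_inv]
    rw [e]
    exact mul_mem ih (Subgroup.subset_closure (hE _ _ hy))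
  | add_neg_cancel x _ y hy ih =>
    have e : x + -y = x * -lamFun x⁻¹ y := by
      rw [mul_eq_add_lam, lamFun_neg, lamFun_lamFun_inv]
    rw [e, neg_eq_inv_lamFun]
    exact mul_mem ih (inv_mem (Subgroup.subset_closure (hE _ _ (hE _ _ hy))))

theorem pair_one_eq_inr (b : B) : pair 1 b = SemidirectProduct.inr b := by
  rw [pair, one_eq_zero]; rfl

theorem pair_mul (b c b' c' : B) : pair b c * pair b' c' = pair (b + lamFun c b') (c * c') := rfl

theorem pair_one_one : pair (1 : B) 1 = 1 := by
  rw [pair_one_eq_inr, map_one]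

theorem pair_one_mul (b c : B) : pair 1 (b * c) = pair 1 b * pair 1 c := by
  simp [pair_one_eq_inr]

theorem pair_self_mul (b c : B) : pair (b * c) (b * c) = pair b b * pair c c := by
  rw [pair_mul, ← mul_eq_add_lam]

theorem Theta_one (c : B) : Theta 1 c = c := by simp [Theta]

theorem Theta_inv_Theta (g : SemiProd B) (c : B) : Theta g⁻¹ (Theta g c) = c := by
  rw [← Theta_mul, inv_mul_cancel, Theta_one]

theorem Theta_Theta_inv (g : SemiProd B) (c : B) : Theta g (Theta g⁻¹ c) = c := by
  rw [← Theta_mul, mul_inv_cancel, Theta_one]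

theorem Theta_pair_one (b c : B) : Theta (pair 1 b) c = lamFun b c := by
  rw [Theta_pair, one_eq_zero, zero_add, neg_zero, add_zero]

/-- With `d = λ_b(c)` one has `Θ_(d,d)(t) = d · t ⋆ d^⋆`. For `t` the preimage of `b` this gives `d
· t = b ⋆ d = b · c`. Applied to values of `η`, it is the defining relation of the structure group.
-/
theorem lamFun_mul_Theta_inv (b c : B) :
    lamFun b c * Theta (pair (lamFun b c) (lamFun b c))⁻¹ b = b * c := by
  set d := lamFun b c
  have h := Theta_Theta_inv (pair d d) b
  rw [Theta_pair, ← mul_eq_add_lam, add_neg_eq_iff_eq_add] at h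
  rw [h, mul_eq_add_lam]

end SkewLeftBrace

/-! ### Additive maps out of the structure group -/

namespace NondegSolution

variable {X : Type*} (S : NondegSolution X)

theorem add_iG (b : S.StructGroup) (x : X) : b + S.iG x = b * S.iG ((S.fHom b).symm x) := by
  apply S.phiEquiv.injective
  show S.phi _ = S.phi _
  rw [phi_add, phi_iG, ← phi_rightStar, rightStar_apply]

theorem lamFun_iG (b : S.StructGroup) (x : X) : lamFun b (S.iG x) = S.iG (S.fHom b x) := by
  apply S.phiEquiv.injective
  show S.phi _ = S.phi _
  rw [phi_lamFun, phi_iG, phi_iG, lamA_iA]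

theorem iG_gTildeInv_add (b : S.StructGroup) (x : X) :
    S.iG (S.gTildeInvHom b x) + b = b + S.iG (S.fHom b x) := by
  apply S.phiEquiv.injective
  show S.phi _ = S.phi _
  rw [phi_add, phi_add, phi_iG, phi_iG, iA_gTildeInv]

/-- Transported along `φ` from the fact that `X` generates the derived group. -/
theorem addClosure_iG : AddSubgroup.closure (Set.range S.iG) = ⊤ := by
  rw [eq_top_iff]
  rintro b -
  obtain ⟨a, rfl⟩ := S.phiEquiv.symm.surjective b
  have hphi : ∀ a, S.phi (S.phiEquiv.symm a) = a := S.phiEquiv.apply_symm_apply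
  have hinj : Injective S.phi := S.phiEquiv.injective
  induction a using S.A_induction with
  | one =>
    have : S.phiEquiv.symm 1 = 0 := hinj (by rw [hphi, ← one_eq_zero, phi_one])
    rw [this]; exact zero_mem _
  | mul a c ha hc =>
    have : S.phiEquiv.symm (a * c) = S.phiEquiv.symm a + S.phiEquiv.symm c :=
      hinj (by rw [phi_add, hphi, hphi, hphi])
    rw [this]; exact add_mem ha hc
  | inv a ha =>
    have : S.phiEquiv.symm a⁻¹ = -S.phiEquiv.symm a := hinj (by rw [phi_neg, hphi, hphi])
    rw [this]; exact neg_mem ha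
  | gen x =>
    have : S.phiEquiv.symm (S.iA x) = S.iG x := hinj (by rw [hphi, phi_iG])
    rw [this]; exact AddSubgroup.subset_closure ⟨x, rfl⟩

/-- A map on the structure group with values in a group is additive as soon as it is compatible with
adding generators on the right. -/
theorem map_add_of_map_add_iG {H : Type*} [AddGroup H] (p : S.StructGroup → H)
    (hp : ∀ b x, p (b + S.iG x) = p b + p (S.iG x)) (b c : S.StructGroup) :
    p (b + c) = p b + p c := by
  have h0 : p 0 = 0 := by
    -- Cancelling `p (i(x))` in the hypothesis at `b = 0` needs a point `x`.
    obtain ⟨x⟩ := S.nonempty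
    simpa using hp 0 x
  have hc : c ∈ AddSubgroup.closure (Set.range S.iG) := S.addClosure_iG ▸ AddSubgroup.mem_top c
  induction hc using AddSubgroup.closure_induction generalizing b with
  | mem c hc => obtain ⟨x, rfl⟩ := hc; exact hp b x
  | zero => rw [add_zero, h0, add_zero]
  | add c d _ _ hc hd => rw [← add_assoc, hd, hc, hd, add_assoc]
  | neg c _ hc =>
    have h1 : ∀ b, p (b + -c) = p b + -p c := fun b => by
      rw [eq_add_neg_iff_add_eq, ← hc, neg_add_cancel_right]
    have h2 := h1 0
    rw [zero_add, h0, zero_add] at h2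
    rw [h1, h2]

section hom

variable {B : Type*} [SkewLeftBrace B] (p : S.StructGroup →* B)

theorem map_iG_fHom (hp : ∀ x y, p (S.iG (S.f x y)) = lamFun (p (S.iG x)) (p (S.iG y)))
    (b : S.StructGroup) : ∀ y, p (S.iG (S.fHom b y)) = lamFun (p b) (p (S.iG y)) := by
  induction b using S.G_induction with
  | one => intro y; rw [map_one, map_one, lamFun_one]; rfl
  | mul b c hb hc =>
    intro y
    rw [map_mul, map_mul, lamFun_mul, Equiv.Perm.mul_apply, hb, hc]
  | inv b hb =>
    intro y
    have := hb ((S.fHom b)⁻¹ y)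
    rw [perm_apply_inv] at this
    rw [map_inv, map_inv, this, lamFun_inv_lamFun]
  | gen x => intro y; rw [fHom_iG, hp]

/-- Since `b ⋆ i(x) = b · i(f_b⁻¹(x))`, a multiplicative morphism that intertwines `f` with `λ`
respects the addition of a generator, and that suffices. -/
theorem map_add_of_map_f (hp : ∀ x y, p (S.iG (S.f x y)) = lamFun (p (S.iG x)) (p (S.iG y)))
    (b c : S.StructGroup) : p (b + c) = p b + p c := by
  refine S.map_add_of_map_add_iG p (fun b x => ?_) b c
  rw [add_iG, map_mul, mul_eq_add_lam, ← S.map_iG_fHom p hp, Equiv.apply_symm_apply]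

end hom

theorem fHom_mul_der (b : S.StructGroup) : ∀ u,
    S.fHom b * S.der u = S.der (S.fHom b u) * S.fHom b := by
  induction b using S.G_induction with
  | one => intro u; simp
  | mul b c hb hc => intro u; rw [map_mul, mul_assoc, hc, ← mul_assoc, hb, mul_assoc]; rfl
  | inv b hb =>
    intro u
    have := hb ((S.fHom b)⁻¹ u)
    rw [perm_apply_inv] at this
    rw [map_inv, inv_mul_eq_iff_eq_mul, ← mul_assoc, this, mul_assoc, mul_inv_cancel, mul_one]
  | gen x => intro u; rw [fHom_iG, f_der]

/-- On a generator `x` the map `b ↦ g̃_b⁻¹ f_b⁻¹` takes the value `der x⁻¹`. For `b ⋆ i(x) = b ·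
i(y)` with `y = f_b⁻¹(x)` it gives `g̃_b⁻¹ (der y)⁻¹ f_b⁻¹`, and moving `f_b⁻¹` to the left turns
`der y` into `der x`. -/
theorem gTildeInvHom_mul_fHom_inv_add (b c : S.StructGroup) :
    S.gTildeInvHom (b + c) * (S.fHom (b + c))⁻¹ =
      S.gTildeInvHom b * (S.fHom b)⁻¹ * (S.gTildeInvHom c * (S.fHom c)⁻¹) := by
  have := S.map_add_of_map_add_iG
    (fun b => Additive.ofMul (S.gTildeInvHom b * (S.fHom b)⁻¹)) (fun b x => by
      apply Additive.toMul.injective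
      simp only [toMul_add, toMul_ofMul]
      have h := S.fHom_mul_der b ((S.fHom b).symm x)
      rw [Equiv.apply_symm_apply] at h
      rw [add_iG, map_mul, map_mul, gTildeInvHom_iG, gTildeInvHom_iG, fHom_iG, fHom_iG]
      have h1 : (S.der x)⁻¹ = (S.gTilde x)⁻¹ * (S.f x)⁻¹ := by rw [der, mul_inv_rev]
      have h2 : (S.der ((S.fHom b).symm x))⁻¹ = (S.gTilde ((S.fHom b).symm x))⁻¹ *
        (S.f ((S.fHom b).symm x))⁻¹ := by rw [der, mul_inv_rev]
      rw [← h1, mul_inv_rev, mul_assoc, ← mul_assoc (S.gTilde _)⁻¹, ← h2, mul_assoc]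
      congr 1
      rw [← mul_inv_rev, ← mul_inv_rev, h]) b c
  exact this

section permGroup

/-- The projection of `𝒢(X, r)` to the first factor. -/
def permFst : S.permGroup →* Equiv.Perm X := (MonoidHom.fst _ _).comp S.permGroup.subtype

/-- The projection of `𝒢(X, r)` to the second factor. -/
def permSnd : S.permGroup →* Equiv.Perm X := (MonoidHom.snd _ _).comp S.permGroup.subtype

theorem permFst_toPerm (b : S.StructGroup) : S.permFst (S.toPerm b) = S.fHom b := rfl

theorem permSnd_toPerm (b : S.StructGroup) : S.permSnd (S.toPerm b) = S.gTildeInvHom b := rfl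

theorem permGroup_ext {b c : S.permGroup} (h1 : S.permFst b = S.permFst c)
    (h2 : S.permSnd b = S.permSnd c) : b = c := Subtype.ext (Prod.ext h1 h2)

theorem permSnd_mul_permFst_inv_add (b c : S.permGroup) :
    S.permSnd (b + c) * (S.permFst (b + c))⁻¹ =
      S.permSnd b * (S.permFst b)⁻¹ * (S.permSnd c * (S.permFst c)⁻¹) := by
  obtain ⟨b, rfl⟩ := S.toPerm_surjective b
  obtain ⟨c, rfl⟩ := S.toPerm_surjective c
  rw [← toPerm_add]
  exact S.gTildeInvHom_mul_fHom_inv_add b c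

theorem toPerm_zero : S.toPerm 0 = 0 := rfl

theorem toPerm_neg (b : S.StructGroup) : S.toPerm (-b) = -S.toPerm b := by
  rw [eq_neg_iff_add_eq_zero, ← toPerm_add, neg_add_cancel, toPerm_zero]

theorem toPerm_lamFun (b c : S.StructGroup) :
    S.toPerm (lamFun b c) = lamFun (S.toPerm b) (S.toPerm c) := by
  rw [lamFun, toPerm_add, toPerm_neg, map_mul, lamFun]

end permGroup

end NondegSolution

/-! ### The constructed map is a non-degenerate solution -/

namespace ConstrData

variable {B : Type*} [SkewLeftBrace B] {a : OrbitReps B} (D : ConstrData a)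

theorem exists_coset (x : D.X) : ∃ i j g, x = D.coset i j g := by
  obtain ⟨i, j, q⟩ := x
  obtain ⟨g, rfl⟩ := QuotientGroup.mk_surjective q
  exact ⟨i, j, g, rfl⟩

theorem act_one (x : D.X) : D.act 1 x = x := by
  obtain ⟨i, j, g, rfl⟩ := D.exists_coset x
  rw [act_coset, one_mul]

theorem act_mul (g h : SemiProd B) (x : D.X) : D.act (g * h) x = D.act g (D.act h x) := by
  obtain ⟨i, j, k, rfl⟩ := D.exists_coset x
  simp only [act_coset, mul_assoc]

theorem act_inv_act (g : SemiProd B) (x : D.X) : D.act g⁻¹ (D.act g x) = x := by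
  rw [← act_mul, inv_mul_cancel, act_one]

theorem act_act_inv (g : SemiProd B) (x : D.X) : D.act g (D.act g⁻¹ x) = x := by
  rw [← act_mul, mul_inv_cancel, act_one]

/-- The action of `(B, ⋆) ⋊ (B, ·)` on `X`. -/
def actHom : SemiProd B →* Equiv.Perm D.X where
  toFun g := ⟨D.act g, D.act g⁻¹, D.act_inv_act g, D.act_act_inv g⟩
  map_one' := Equiv.ext D.act_one
  map_mul' g h := Equiv.ext (D.act_mul g h)

theorem actHom_apply (g : SemiProd B) (x : D.X) : D.actHom g x = D.act g x := rfl

theorem eta_act (g : SemiProd B) (x : D.X) : D.eta (D.act g x) = Theta g (D.eta x) := by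
  obtain ⟨i, j, k, rfl⟩ := D.exists_coset x
  rw [act_coset, eta_coset, eta_coset, Theta_mul]

/-- The stabiliser of `hK` is `hKh⁻¹`; this turns the two conditions on `K` into fixed-point
statements. -/
theorem act_coset_eq_iff (g h : SemiProd B) (i : D.I) (j : D.J i) :
    D.act g (D.coset i j h) = D.coset i j h ↔
      g ∈ (D.K i j).map (MulAut.conj h).toMonoidHom := by
  rw [Subgroup.mem_map_equiv, act_coset]
  have : D.coset i j (g * h) = D.coset i j h ↔
      ((g * h : SemiProd B) : SemiProd B ⧸ D.K i j) = (h : SemiProd B ⧸ D.K i j) := by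
    simp [coset]
  rw [this, eq_comm, QuotientGroup.eq, ← mul_assoc]
  rfl

/-- The right action of `(B, ·)` on `X` that gives the second component of the solution. -/
def rightAct (c : B) (x : D.X) : D.X :=
  D.act (pair (lamFun (D.eta x) c) (lamFun (D.eta x) c))⁻¹ x

theorem r_apply (x y : D.X) :
    D.r (x, y) = (D.act (pair 1 (D.eta x)) y, D.rightAct (D.eta y) x) := by
  simp only [r, rightAct, Theta_pair_one]

theorem lamFun_mul_eta_rightAct (c : B) (x : D.X) :
    lamFun (D.eta x) c * D.eta (D.rightAct c x) = D.eta x * c := by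
  rw [rightAct, eta_act, lamFun_mul_Theta_inv]

theorem rightAct_one (x : D.X) : D.rightAct 1 x = x := by
  rw [rightAct, lamFun_right_one, pair_one_one, inv_one, act_one]

/-- The elements `(d, d)` multiply like `d`, so it suffices that `λ_(η x)(c · w)` factors as `λ_(η
x)(c)` times `λ_(η x')(w)`, where `x'` is `x` moved by `c`. This follows from `η x · c = λ_(η x)(c)
· η x'`. -/
theorem rightAct_rightAct (c w : B) (x : D.X) :
    D.rightAct w (D.rightAct c x) = D.rightAct (c * w) x := by
  have h : lamFun (D.eta x) (c * w) =
      lamFun (D.eta x) c * lamFun (D.eta (D.rightAct c x)) w := by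
    rw [mul_eq_add_lam c w, lamFun_add, mul_eq_add_lam (lamFun _ c), ← lamFun_mul, ← lamFun_mul,
      lamFun_mul_eta_rightAct]
  rw [rightAct.eq_def _ (c * w), h, pair_self_mul, mul_inv_rev, act_mul]
  rfl

theorem braid_r : braidLeft D.r ∘ braidRight D.r ∘ braidLeft D.r =
    braidRight D.r ∘ braidLeft D.r ∘ braidRight D.r := by
  funext ⟨x, y, z⟩
  simp only [comp_apply, braidLeft, braidRight, r_apply, Prod.mk.injEq]
  have hl : ∀ b w, D.eta (D.act (pair 1 b) w) = lamFun b (D.eta w) := fun b w => by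
    rw [eta_act, Theta_pair_one]
  have hm := D.lamFun_mul_eta_rightAct
  refine ⟨?_, ?_, ?_⟩
  · rw [← act_mul, ← act_mul, ← pair_one_mul, ← pair_one_mul, hl, hm]
  · have hv := hm (lamFun (D.eta y) (D.eta z)) x
    rw [rightAct.eq_def _ (D.eta z), rightAct.eq_def _ (D.eta (D.act _ z)), hl (D.eta x) y,
      hl _ z, ← lamFun_mul, hm, lamFun_mul, ← act_mul, ← act_mul]
    congr 1
    -- Both sides move `y` by an element of the semidirect product. With `q = λ_(η y)(η z)`, `p =
    -- λ_(η x)(q)` and `w` the value of `η` at `x` moved by `q`, the claim is `(1, η x)(q, q) = (p,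
    -- p)(1, w)`, and `hv` matches the second components.
    rw [inv_mul_eq_iff_eq_mul, ← mul_assoc, eq_mul_inv_iff_mul_eq, pair_mul, pair_mul,
      lamFun_right_one, hl, hv, one_eq_zero, zero_add, add_zero]
  · rw [rightAct_rightAct, rightAct_rightAct, hl, hm]

theorem r_bijective : Bijective D.r := by
  have hl : ∀ b w, D.eta (D.act (pair 1 b) w) = lamFun b (D.eta w) := fun b w => by
    rw [eta_act, Theta_pair_one]
  constructor
  · rintro ⟨x, y⟩ ⟨x', y'⟩ h
    rw [r_apply, r_apply, Prod.mk.injEq] at h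
    obtain ⟨h1, h2⟩ := h
    -- The element `d` that moves `x` is `η` of the first output, so the outputs determine `x` and
    -- then `y`.
    have h3 := congrArg D.eta h1
    rw [hl, hl] at h3
    rw [rightAct, rightAct, h3] at h2
    have hx := congrArg (D.act (pair (lamFun (D.eta x') (D.eta y'))
      (lamFun (D.eta x') (D.eta y')))) h2
    rw [act_act_inv, act_act_inv] at hx
    subst hx
    have hy := congrArg (D.act (pair 1 (D.eta x))⁻¹) h1
    rw [act_inv_act, act_inv_act] at hy
    rw [hy]
  · rintro ⟨u, w⟩
    refine ⟨(D.act (pair (D.eta u) (D.eta u)) w,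
      D.act (pair 1 (D.eta (D.act (pair (D.eta u) (D.eta u)) w)))⁻¹ u), ?_⟩
    rw [r_apply, act_act_inv, rightAct, ← hl, act_act_inv, act_inv_act]

/-- The solution constructed from the data. -/
def solution : NondegSolution D.X where
  r := D.r
  nonempty := by
    obtain ⟨i, hi⟩ := D.I_nonempty
    obtain ⟨j⟩ := D.J_nonempty ⟨i, hi⟩
    exact ⟨D.coset ⟨i, hi⟩ j 1⟩
  bijective := D.r_bijective
  braid := D.braid_r
  f_bijective x := by
    simp only [r_apply]
    exact (D.actHom (pair 1 (D.eta x))).bijective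
  g_bijective y := by
    simp only [r_apply]
    refine ⟨fun x x' h => ?_, fun w => ⟨D.rightAct (D.eta y)⁻¹ w, ?_⟩⟩
    · have := congrArg (D.rightAct (D.eta y)⁻¹) h
      simpa only [rightAct_rightAct, mul_inv_cancel, rightAct_one] using this
    · simp only [rightAct_rightAct, inv_mul_cancel, rightAct_one]

theorem solution_f (x : D.X) : D.solution.f x = D.actHom (pair 1 (D.eta x)) := by
  ext1 y
  exact congrArg Prod.fst (D.r_apply x y)

theorem solution_g (x y : D.X) : D.solution.g y x = D.rightAct (D.eta y) x :=
  congrArg Prod.snd (D.r_apply x y)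

theorem solution_gTilde_inv (x : D.X) :
    (D.solution.gTilde x)⁻¹ = D.actHom (pair (D.eta x) (D.eta x)) := by
  rw [inv_eq_iff_eq_inv, ← map_inv]
  ext1 z
  show D.solution.g ((D.solution.f z).symm x) z = D.act _ z
  obtain ⟨y, rfl⟩ := (D.solution.f z).surjective x
  rw [Equiv.symm_apply_apply, solution_g, solution_f, actHom_apply, eta_act, Theta_pair_one]
  rfl

theorem solution_squareFree (h : D.SquareFreeConditions) : D.solution.SquareFree := by
  intro x
  obtain ⟨i, j, g, rfl⟩ := D.exists_coset x
  obtain ⟨h1, h2⟩ := h g.left.toAdd g.right i j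
  have hf := (D.act_coset_eq_iff _ g i j).mpr h1
  have hg := (D.act_coset_eq_iff _ g i j).mpr h2
  -- As `(1, η x)` fixes `x`, equivariance gives `λ_(η x)(η x) = η x`; hence `d = η x` when both
  -- arguments of `r` are `x`.
  have hl := D.eta_act (pair 1 (D.eta (D.coset i j g))) (D.coset i j g)
  change D.act (pair 1 (D.eta (D.coset i j g))) _ = _ at hf
  change D.act (pair (D.eta (D.coset i j g)) (D.eta (D.coset i j g))) _ = _ at hg
  rw [hf, Theta_pair_one] at hl
  show D.r _ = _
  rw [r_apply, hf, rightAct, ← hl]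
  congr 1
  have := D.act_inv_act (pair (D.eta (D.coset i j g)) (D.eta (D.coset i j g))) (D.coset i j g)
  rwa [hg] at this

/-! ### The permutation group of the constructed solution -/

/-- The morphism from the structure group of the constructed solution to `(B, ·)`. -/
noncomputable def structHom : D.solution.StructGroup →* B :=
  D.solution.liftG D.eta fun x y => by
    rw [solution_f, solution_g, actHom_apply, eta_act, Theta_pair_one, lamFun_mul_eta_rightAct]

theorem structHom_iG (x : D.X) : D.structHom (D.solution.iG x) = D.eta x :=
  D.solution.liftG_iG _ _ x

theorem structHom_add (b c : D.solution.StructGroup) :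
    D.structHom (b + c) = D.structHom b + D.structHom c :=
  D.solution.map_add_of_map_f D.structHom (fun x y => by
    rw [structHom_iG, structHom_iG, structHom_iG, solution_f, actHom_apply, eta_act,
      Theta_pair_one]) b c

theorem iUnion_orbits_subset_range_eta : (⋃ i ∈ D.I, (i : Set B)) ⊆ Set.range D.eta := by
  intro b hb
  simp only [Set.mem_iUnion] at hb
  obtain ⟨i, hi, hb⟩ := hb
  obtain ⟨j⟩ := D.J_nonempty ⟨i, hi⟩
  have ha := a.rep_mem i
  obtain ⟨c, hc⟩ := i.2
  rw [← hc] at hb ha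
  obtain ⟨g, rfl⟩ := hb
  obtain ⟨h, hh⟩ := ha
  refine ⟨D.coset ⟨i, hi⟩ j (g * h⁻¹), ?_⟩
  rw [eta_coset, Theta_mul]
  simp only at hh ⊢
  rw [← hh, Theta_inv_Theta]

theorem structHom_surjective : Surjective D.structHom := by
  have h1 : AddSubgroup.closure (Set.range D.eta) = ⊤ :=
    top_le_iff.mp (D.generates ▸ AddSubgroup.closure_mono D.iUnion_orbits_subset_range_eta)
  have h2 : Subgroup.closure (Set.range D.eta) = ⊤ :=
    closure_eq_top_of_addClosure (fun b e ⟨x, hx⟩ =>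
      ⟨D.act (pair 1 b) x, by rw [eta_act, Theta_pair_one, hx]⟩) h1
  rw [← MonoidHom.range_eq_top, ← top_le_iff, ← h2, Subgroup.closure_le]
  rintro _ ⟨x, rfl⟩
  exact ⟨_, D.structHom_iG x⟩

/-- The morphism `b ↦ ((1, b), (b, b))` from `(B, ·)` to pairs of permutations of `X`. -/
def toPermPair : B →* Equiv.Perm D.X × Equiv.Perm D.X :=
  MonoidHom.mk' (fun b => (D.actHom (pair 1 b), D.actHom (pair b b))) fun b c => by
    simp only [pair_one_mul, pair_self_mul, map_mul, Prod.mk_mul_mk]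

theorem mem_core_of_actHom_eq_one {g : SemiProd B} (hg : D.actHom g = 1) :
    g ∈ ⨅ i, ⨅ j, (D.K i j).normalCore := by
  simp only [Subgroup.mem_iInf]
  intro i j h
  -- Membership in the core asks for `h g h⁻¹ ∈ K`, that is, `g` fixes `h⁻¹K`.
  have h1 : D.act g (D.coset i j h⁻¹) = D.coset i j h⁻¹ := DFunLike.congr_fun hg _
  rw [act_coset_eq_iff, Subgroup.mem_map_equiv] at h1
  simpa using h1

theorem toPermPair_injective : Injective D.toPermPair := by
  rw [injective_iff_map_eq_one]
  intro b hb
  have h : b ∈ ({1} : Set B) := by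
    rw [← D.core_trivial]
    exact ⟨D.mem_core_of_actHom_eq_one (congrArg Prod.fst hb),
      D.mem_core_of_actHom_eq_one (congrArg Prod.snd hb)⟩
  exact h

theorem toPermPair_structHom (b : D.solution.StructGroup) :
    D.toPermPair (D.structHom b) = D.solution.toPerm b := by
  have h : D.toPermPair.comp D.structHom =
      D.solution.permGroup.subtype.comp D.solution.toPerm :=
    PresentedGroup.ext fun x => by
      show D.toPermPair (D.structHom (D.solution.iG x)) = D.solution.toPerm (D.solution.iG x)
      rw [structHom_iG, NondegSolution.toPerm_iG, solution_f, solution_gTilde_inv]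
      rfl
  exact DFunLike.congr_fun h b

/-- `toPerm` factors as the surjection `structHom` followed by the injection `toPermPair`, so the
latter identifies `B` with the permutation group. Additivity is checked on the structure group,
where `toPerm` and `structHom` are both additive. -/
theorem nonempty_permGroup_ringEquiv : Nonempty (D.solution.permGroup ≃+* B) := by
  have hmem : ∀ b, D.toPermPair b ∈ D.solution.permGroup := fun b => by
    obtain ⟨s, rfl⟩ := D.structHom_surjective b
    rw [toPermPair_structHom]
    exact Subtype.mem _
  have hs : ∀ s, (⟨D.toPermPair (D.structHom s), hmem _⟩ : D.solution.permGroup) =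
      D.solution.toPerm s := fun s => Subtype.ext (D.toPermPair_structHom s)
  refine ⟨RingEquiv.symm
    { Equiv.ofBijective (fun b => (⟨D.toPermPair b, hmem b⟩ : D.solution.permGroup))
        ⟨fun b c h => D.toPermPair_injective (congrArg Subtype.val h), fun c => ?_⟩ with
      map_mul' := fun b c => Subtype.ext (map_mul D.toPermPair b c)
      map_add' := fun b c => ?_ }⟩
  · obtain ⟨s, rfl⟩ := D.solution.toPerm_surjective c
    exact ⟨D.structHom s, hs s⟩
  · obtain ⟨s, rfl⟩ := D.structHom_surjective b
    obtain ⟨t, rfl⟩ := D.structHom_surjective c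
    have h := hs (s + t)
    rw [NondegSolution.toPerm_add, ← hs, ← hs] at h
    simp only [structHom_add] at h
    exact h

end ConstrData

/-! ### Orbit decomposition of sets acted on by the semidirect product -/

/-- A set with an action of `(B, ⋆) ⋊ (B, ·)` and an equivariant map to `B` is a disjoint union of
coset spaces of stabilisers of points over the chosen representatives. -/
theorem ConstrData.exists_equiv_of_action {B : Type u} [SkewLeftBrace B] {Z : Type v} [Nonempty Z]
    (ω : SemiProd B →* Equiv.Perm Z) (η : Z → B) (hη : ∀ g z, η (ω g z) = Theta g (η z))
    (hgen : AddSubgroup.closure (Set.range η) = ⊤)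
    (hω : ∀ b, ω (pair 1 b) = 1 → ω (pair b b) = 1 → b = 1) (a : OrbitReps B) :
    ∃ (D : ConstrData.{u, v} a) (F : D.X ≃ Z),
      (∀ g x, F (D.act g x) = ω g (F x)) ∧ ∀ x, η (F x) = D.eta x := by
  let s : Setoid Z :=
    { r := fun z z' => ∃ g, ω g z = z'
      iseqv :=
        { refl := fun z => ⟨1, by simp⟩
          symm := by
            rintro z _ ⟨g, rfl⟩
            exact ⟨g⁻¹, by simp⟩
          trans := by
            rintro z _ _ ⟨g, rfl⟩ ⟨h, rfl⟩
            exact ⟨h * g, by simp⟩ } }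
  let I : Set (orbits B) := {i | ∃ z, η z ∈ (i : Set B)}
  -- The index set for `i` consists of the orbits in `Z` with a point over `a_i`. Choosing that
  -- point `pt` over `a_i` itself makes its stabiliser lie in `St(a_i)`.
  let J : I → Type v := fun i => {o : Quotient s // ∃ z, η z = a.rep i ∧ Quotient.mk s z = o}
  choose pt hpt hptj using fun (i : I) (j : J i) => j.2
  have hrep : ∀ (i : orbits B) (b : B), b ∈ (i : Set B) → ∃ g, Theta g b = a.rep i := by
    intro i b hb
    have ha := a.rep_mem i
    obtain ⟨c, hc⟩ := i.2
    rw [← hc] at hb ha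
    obtain ⟨g, rfl⟩ := hb
    obtain ⟨h, hh⟩ := ha
    exact ⟨h * g⁻¹, by rw [← hh, Theta_mul, Theta_inv_Theta]⟩
  have horb : ∀ b : B, ∃ i : orbits B, b ∈ (i : Set B) := fun b =>
    ⟨⟨_, b, rfl⟩, 1, Theta_one b⟩
  have horb_eq : ∀ (i i' : orbits B) (b : B), b ∈ (i : Set B) → b ∈ (i' : Set B) → i = i' := by
    have key : ∀ (i i' : orbits B) (b : B), b ∈ (i : Set B) → b ∈ (i' : Set B) →
        (i : Set B) ⊆ i' := by
      rintro ⟨_, c, rfl⟩ ⟨_, c', rfl⟩ b ⟨g, hg⟩ ⟨g', hg'⟩ _ ⟨h, rfl⟩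
      refine ⟨h * g⁻¹ * g', ?_⟩
      simp only at hg hg' ⊢
      rw [Theta_mul, hg', ← hg, Theta_mul, Theta_inv_Theta]
    exact fun i i' b h h' => Subtype.ext ((key i i' b h h').antisymm (key i' i b h' h))
  have hmem : ∀ (i : orbits B) (b : B) (g : SemiProd B), b ∈ (i : Set B) →
      Theta g b ∈ (i : Set B) := by
    rintro ⟨_, c, rfl⟩ b g ⟨h, rfl⟩
    exact ⟨g * h, Theta_mul g h c⟩
  let K : ∀ i, J i → Subgroup (SemiProd B) := fun i j =>
    (MulAction.stabilizer (Equiv.Perm Z) (pt i j)).comap ω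
  have hK : ∀ i j g, g ∈ K i j ↔ ω g (pt i j) = pt i j := fun i j g => Iff.rfl
  have hsurj : ∀ z, ∃ i j g, ω g (pt i j) = z := by
    intro z
    obtain ⟨i, hi⟩ := horb (η z)
    obtain ⟨g, hg⟩ := hrep i _ hi
    -- Translating `z` by `g` puts it over `a_i`, so its orbit is one of the indices.
    let j : J ⟨i, z, hi⟩ := ⟨_, ω g z, by rw [hη, hg], rfl⟩
    obtain ⟨h, hh⟩ : ∃ h, ω h (pt _ j) = ω g z := Quotient.exact (hptj _ j)
    exact ⟨_, j, g⁻¹ * h, by simp [hh]⟩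
  let D : ConstrData.{u, v} a :=
    { I := I
      I_nonempty := by
        obtain ⟨z⟩ := ‹Nonempty Z›
        obtain ⟨i, hi⟩ := horb (η z)
        exact ⟨i, z, hi⟩
      generates := by
        rw [← top_le_iff, ← hgen]
        apply AddSubgroup.closure_mono
        rintro _ ⟨z, rfl⟩
        obtain ⟨i, hi⟩ := horb (η z)
        exact Set.mem_biUnion (⟨z, hi⟩ : i ∈ I) hi
      J := J
      J_nonempty := by
        rintro ⟨i, z, hi⟩
        obtain ⟨g, hg⟩ := hrep i _ hi
        exact ⟨⟨_, ω g z, by rw [hη, hg], rfl⟩⟩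
      K := K
      K_le := fun i j g hg => by
        rw [mem_stab, ← hpt i j, ← hη, (hK i j g).mp hg]
      core_trivial := by
        have hcore : ∀ g ∈ ⨅ i, ⨅ j, (K i j).normalCore, ω g = 1 := by
          intro g hg
          ext z
          obtain ⟨i, j, h, rfl⟩ := hsurj z
          simp only [Subgroup.mem_iInf] at hg
          -- The conjugate `h⁻¹ g h` fixes the base point, so `g` fixes its translate by `h`.
          have := (hK i j _).mp (hg i j h⁻¹)
          simp only [map_mul, map_inv, inv_inv, Equiv.Perm.mul_apply] at this
          rw [Equiv.Perm.inv_eq_iff_eq] at this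
          exact this
        ext b
        simp only [Set.mem_ofPred_eq, Set.mem_singleton_iff]
        constructor
        · rintro ⟨h1, h2⟩
          exact hω b (hcore _ h1) (hcore _ h2)
        · rintro rfl
          rw [pair_one_one]
          exact ⟨one_mem _, one_mem _⟩ }
  let F : D.X → Z := fun x => Quotient.liftOn' x.2.2 (fun g => ω g (pt x.1 x.2.1))
    (fun g h hgh => by
      have := (hK _ _ _).mp (QuotientGroup.leftRel_apply.mp hgh)
      rw [map_mul, map_inv, Equiv.Perm.mul_apply, Equiv.Perm.inv_eq_iff_eq] at this
      exact this.symm)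
  have hF : ∀ (i : I) (j : J i) g, F (D.coset i j g) = ω g (pt i j) := fun _ _ _ => rfl
  have hbij : Bijective F := by
    constructor
    · intro x y hxy
      obtain ⟨i, j, g, rfl⟩ := D.exists_coset x
      obtain ⟨i', j', g', rfl⟩ := D.exists_coset y
      rw [hF, hF] at hxy
      -- Equivariance puts the values of `η` at the two equal points in the orbits `i` and `i'`,
      -- which therefore meet.
      have hi : i = i' := by
        have h1 := congrArg η hxy
        rw [hη, hη, hpt, hpt] at h1
        exact Subtype.ext (horb_eq i i' _ (hmem _ _ g (a.rep_mem _))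
          (h1 ▸ hmem _ _ g' (a.rep_mem _)))
      subst hi
      have hj : j = j' := by
        apply Subtype.ext
        rw [← hptj i j, ← hptj i j']
        refine Quotient.sound ⟨g'⁻¹ * g, ?_⟩
        rw [map_mul, Equiv.Perm.mul_apply, hxy]
        simp
      subst hj
      have hg : ((g : SemiProd B) : SemiProd B ⧸ D.K i j) = g' := by
        rw [QuotientGroup.eq]
        refine (hK i j _).mpr ?_
        rw [map_mul, Equiv.Perm.mul_apply, ← hxy]
        simp
      simp only [ConstrData.coset, hg]
    · intro z
      obtain ⟨i, j, g, rfl⟩ := hsurj z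
      exact ⟨D.coset i j g, hF i j g⟩
  refine ⟨D, Equiv.ofBijective F hbij, fun g x => ?_, fun x => ?_⟩
  · obtain ⟨i, j, h, rfl⟩ := D.exists_coset x
    simp only [Equiv.ofBijective_apply, ConstrData.act_coset]
    rw [hF, hF, map_mul, Equiv.Perm.mul_apply]
  · obtain ⟨i, j, h, rfl⟩ := D.exists_coset x
    simp only [Equiv.ofBijective_apply, ConstrData.eta_coset]
    rw [hF, hη, hpt]

/-! ### From a square-free solution to the data -/

namespace NondegSolution

variable {X B : Type*} (S : NondegSolution X) [SkewLeftBrace B] (e : S.permGroup ≃+* B)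

theorem equiv_lamFun (b c : S.permGroup) : e (lamFun b c) = lamFun (e b) (e c) := by
  have hneg : e (-b) = -e b := by
    rw [eq_neg_iff_add_eq_zero, ← map_add, neg_add_cancel]
    -- `e` is only known to preserve the two operations; `e 0 = 0` comes from cancellation in `e 0 +
    -- e 0 = e 0`.
    exact add_eq_left.mp ((map_add e 0 0).symm.trans (congrArg e (add_zero 0)))
  rw [lamFun, map_add, map_mul, hneg, lamFun]

/-- The action of `(B, ⋆) ⋊ (B, ·)` on `X` for `B ≅ 𝒢(X, r)`: if `b` corresponds to the pair
`(π, ρ)`, then `(1, b)` acts as `π` and `(b, b)` acts as `ρ`. -/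
noncomputable def semiProdAct : SemiProd B →* Equiv.Perm X :=
  SemidirectProduct.lift
    (MonoidHom.mk' (fun b : Multiplicative B =>
        S.permSnd (e.symm b.toAdd) * (S.permFst (e.symm b.toAdd))⁻¹) fun b c => by
      rw [toAdd_mul, map_add, permSnd_mul_permFst_inv_add])
    (S.permFst.comp e.symm.toMulEquiv.toMonoidHom) fun b => by
      refine MonoidHom.ext fun c => ?_
      obtain ⟨b, rfl⟩ := e.surjective b
      obtain ⟨c, rfl⟩ := Multiplicative.ofAdd.surjective c
      obtain ⟨c, rfl⟩ := e.surjective c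
      show S.permSnd (e.symm (lamFun (e b) (e c))) * (S.permFst (e.symm (lamFun (e b) (e c))))⁻¹ =
        S.permFst (e.symm (e b)) * (S.permSnd (e.symm (e c)) * (S.permFst (e.symm (e c)))⁻¹) *
          (S.permFst (e.symm (e b)))⁻¹
      -- Write `σ` for `ρ π⁻¹`. As `b ⋆ λ_b(c) = b · c`, additivity gives `σ(b) σ(λ_b(c)) = σ(b · c)
      -- = ρ_b σ(c) π_b⁻¹`; cancelling `σ(b) = ρ_b π_b⁻¹` leaves conjugation by `π_b`.
      have h := S.permSnd_mul_permFst_inv_add b (lamFun b c)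
      rw [← mul_eq_add_lam, map_mul, map_mul] at h
      rw [← equiv_lamFun, e.symm_apply_apply, e.symm_apply_apply, e.symm_apply_apply,
        ← mul_right_inj (S.permSnd b * (S.permFst b)⁻¹), ← h]
      group

theorem semiProdAct_pair (b c : S.permGroup) : S.semiProdAct e (pair (e b) (e c)) =
    S.permSnd b * (S.permFst b)⁻¹ * S.permFst c := by
  show S.permSnd (e.symm (e b)) * (S.permFst (e.symm (e b)))⁻¹ * S.permFst (e.symm (e c)) = _
  rw [e.symm_apply_apply, e.symm_apply_apply]

theorem semiProdAct_pair_one (b : S.permGroup) :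
    S.semiProdAct e (pair 1 (e b)) = S.permFst b := by
  have h := S.semiProdAct_pair e 1 b
  simpa only [map_one, inv_one, one_mul] using h

theorem semiProdAct_pair_self (b : S.permGroup) :
    S.semiProdAct e (pair (e b) (e b)) = S.permSnd b := by
  rw [semiProdAct_pair, inv_mul_cancel_right]

/-- The map `x ↦ (f_x, g̃_x⁻¹)` followed by an isomorphism `𝒢(X, r) ≅ B`. -/
noncomputable def permEta (x : X) : B := e (S.toPerm (S.iG x))

theorem permEta_permFst (b : S.permGroup) (x : X) :
    S.permEta e (S.permFst b x) = lamFun (e b) (S.permEta e x) := by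
  obtain ⟨b, rfl⟩ := S.toPerm_surjective b
  rw [permFst_toPerm, permEta, ← lamFun_iG, toPerm_lamFun, equiv_lamFun, permEta]

theorem permEta_permSnd_add (b : S.permGroup) (x : X) :
    S.permEta e (S.permSnd b x) + e b = e b + S.permEta e (S.permFst b x) := by
  obtain ⟨b, rfl⟩ := S.toPerm_surjective b
  rw [permSnd_toPerm, permFst_toPerm, permEta, permEta, ← map_add e, ← map_add e, ← toPerm_add,
    ← toPerm_add, iG_gTildeInv_add]

/-- The first factor acts through `ρ π⁻¹`, and `i(ρ x) ⋆ b = b ⋆ i(π x)` says that `ρ π⁻¹` becomes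
conjugation by `b` for `⋆`; the second factor acts through `π`, which becomes `λ`. -/
theorem permEta_semiProdAct (g : SemiProd B) (x : X) :
    S.permEta e (S.semiProdAct e g x) = Theta g (S.permEta e x) := by
  obtain ⟨b, c⟩ := g
  obtain ⟨b, rfl⟩ := Multiplicative.ofAdd.surjective b
  obtain ⟨b, rfl⟩ := e.surjective b
  obtain ⟨c, rfl⟩ := e.surjective c
  change S.permEta e (S.semiProdAct e (pair (e b) (e c)) x) =
    Theta (pair (e b) (e c)) (S.permEta e x)
  rw [semiProdAct_pair, Theta_pair, eq_add_neg_iff_add_eq, Equiv.Perm.mul_apply,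
    Equiv.Perm.mul_apply, permEta_permSnd_add, perm_apply_inv, permEta_permFst]

theorem addClosure_permEta : AddSubgroup.closure (Set.range (S.permEta e)) = ⊤ := by
  rw [eq_top_iff]
  rintro b -
  let p : S.StructGroup →+ B := AddMonoidHom.mk' (fun b => e (S.toPerm b)) fun b c => by
    rw [toPerm_add, map_add]
  obtain ⟨b, rfl⟩ : ∃ c, p c = b := (e.surjective.comp S.toPerm_surjective) b
  have hb : b ∈ AddSubgroup.closure (Set.range S.iG) := S.addClosure_iG ▸ AddSubgroup.mem_top b
  have h := AddSubgroup.mem_map_of_mem p hb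
  rw [AddMonoidHom.map_closure, ← Set.range_comp] at h
  exact h

theorem eq_one_of_semiProdAct_eq_one (b : B) (h1 : S.semiProdAct e (pair 1 b) = 1)
    (h2 : S.semiProdAct e (pair b b) = 1) : b = 1 := by
  obtain ⟨b, rfl⟩ := e.surjective b
  rw [semiProdAct_pair_one] at h1
  rw [semiProdAct_pair_self] at h2
  rw [S.permGroup_ext (b := b) (c := 1) (by rw [h1, map_one]) (by rw [h2, map_one]), map_one]

theorem semiProdAct_permEta (x : X) :
    S.semiProdAct e (pair 1 (S.permEta e x)) = S.f x ∧
      S.semiProdAct e (pair (S.permEta e x) (S.permEta e x)) = (S.gTilde x)⁻¹ := by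
  rw [permEta, semiProdAct_pair_one, semiProdAct_pair_self, permFst_toPerm, permSnd_toPerm, fHom_iG,
    gTildeInvHom_iG]
  exact ⟨rfl, rfl⟩

theorem SquareFree.f_self {S : NondegSolution X} (h : S.SquareFree) (x : X) : S.f x x = x :=
  congrArg Prod.fst (h x)

theorem SquareFree.gTilde_inv_self {S : NondegSolution X} (h : S.SquareFree) (x : X) :
    (S.gTilde x)⁻¹ x = x := by
  have h1 : S.g x x = x := congrArg Prod.snd (h x)
  have := S.gTilde_inv_r x x
  rwa [h1, h.f_self] at this

/-- Every square-free solution is isomorphic to a constructed one. -/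
theorem SquareFree.exists_constrData {Z : Type v} {T : NondegSolution Z} (hT : T.SquareFree)
    {B : Type u} [SkewLeftBrace B] (e : T.permGroup ≃+* B) (a : OrbitReps B) :
    ∃ D : ConstrData.{u, v} a, D.SquareFreeConditions ∧
      ∃ F : D.X ≃ Z, D.solution.IsMorphism T F := by
  have := T.nonempty
  obtain ⟨D, F, hF, hη⟩ := ConstrData.exists_equiv_of_action (T.semiProdAct e) (T.permEta e)
    (T.permEta_semiProdAct e) (T.addClosure_permEta e) (T.eq_one_of_semiProdAct_eq_one e) a
  refine ⟨D, fun b c i j => ?_, F, fun x y => ?_⟩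
  -- Carried over by `F`, the two conditions say that `f_z` and `g̃_z⁻¹` fix `z`.
  · rw [← D.act_coset_eq_iff, ← D.act_coset_eq_iff, ← D.eta_coset i j, ← hη]
    constructor <;> apply F.injective
    · rw [hF, (T.semiProdAct_permEta e _).1, hT.f_self]
    · rw [hF, (T.semiProdAct_permEta e _).2, hT.gTilde_inv_self]
  · have h1 : F (D.solution.f x y) = T.f (F x) (F y) := by
      rw [D.solution_f, D.actHom_apply, hF, ← hη, (T.semiProdAct_permEta e _).1]
    have h2 := D.solution.gTilde_inv_r x y
    rw [D.solution_gTilde_inv, D.actHom_apply] at h2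
    have h3 := congrArg F h2
    rw [hF, ← hη, (T.semiProdAct_permEta e _).2, h1] at h3
    -- The value `g_y(x)` is determined by `f` and `g̃` as the point that `g̃⁻¹`, taken at `f_x(y)`,
    -- sends to `x`; so a map compatible with `f` and `g̃⁻¹` is compatible with `g`.
    have h4 := (T.gTilde (T.f (F x) (F y)))⁻¹.injective (h3.trans (T.gTilde_inv_r _ _).symm)
    rw [T.r_eq, D.solution.r_eq, Prod.map_apply, h1, h4]

end NondegSolution

theorem mainTheorem9 :
    (∀ (B : Type u) [SkewLeftBrace B] (a : SkewLeftBrace.OrbitReps B) (D : ConstrData.{u, v} a),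
      D.SquareFreeConditions →
        ∃ S : NondegSolution D.X,
          S.r = D.r ∧ Nonempty (S.permGroup ≃+* B) ∧ S.SquareFree) ∧
    (∀ (Z : Type v) (T : NondegSolution Z), T.SquareFree →
      ∀ (B : Type u) [SkewLeftBrace B], Nonempty (T.permGroup ≃+* B) →
        ∀ a : SkewLeftBrace.OrbitReps B,
          ∃ D : ConstrData.{u, v} a, D.SquareFreeConditions ∧
            ∃ S : NondegSolution D.X, S.r = D.r ∧
              ∃ F : D.X ≃ Z, S.IsMorphism T F) := by
  refine ⟨fun B _ a D hD =>
    ⟨D.solution, rfl, D.nonempty_permGroup_ringEquiv, D.solution_squareFree hD⟩, ?_⟩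
  rintro Z T hT B _ ⟨e⟩ a
  obtain ⟨D, hD, F, hF⟩ := hT.exists_constrData e a
  exact ⟨D, hD, D.solution, rfl, F, hF⟩
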